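/- Let $\kappa$ be an uncountable cardinal with $\kappa^{<\kappa}=\kappa$. Equip $2^\kappa$ with the topology generated by the sets $N_p=\{\eta\in 2^\kappa : \eta\restriction\alpha=p\}$ for $\alpha<\kappa$ and $p\in 2^\alpha$, and $2^\kappa\times 2^\kappa$ with the product topology. The Borel sets of such a space are obtained by closing the topology under complements and under unions and intersections of length at most $\kappa$; a function $2^\kappa\to 2^\kappa$ is Borel if inverse images of open sets are Borel. Let $\mathcal E^B_\kappa$ be the set of all equivalence relations on $2^\kappa$ that are Borel subsets of $2^\kappa\times 2^\kappa$, and for $E,E'\in\mathcal E^B_\kappa$ write $E\le_B E'$ if there is a Borel function $f\colon 2^\kappa\to 2^\kappa$ such that $\eta\mathrel{E}\xi\iff f(\eta)\mathrel{E'}f(\xi)$ for all $\eta,\xi\in 2^\kappa$. A set $C\subseteq\kappa$ is $\omega$-cub if it is unbounded in $\kappa$ and contains the supremum of every strictly increasing sequence of length $\omega$ of its elements; a set is $\omega$-stationary if it meets every $\omega$-cub set, and stationary if it meets every closed unbounded subset of $\kappa$. For $X,Y\subseteq\kappa$ write $X\subset_{\mathrm{NS}(\omega)}Y$ if $X\setminus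 Y$ is not $\omega$-stationary, and $X\subset_{\mathrm{NS}}Y$ if $X\setminus Y$ is not stationary. Then (in ZFC) $\langle\mathcal P(\kappa),\subset_{\mathrm{NS}(\omega)}\rangle$ embeds into $\langle\mathcal E^B_\kappa,\le_B\rangle$: there is a one-to-one map $F\colon\mathcal P(\kappa)\to\mathcal E^B_\kappa$ such that for all $X,Y\subseteq\kappa$, $$X\subset_{\mathrm{NS}(\omega)}Y\iff F(X)\le_B F(Y).$$ In particular, if the continuum hypothesis $2^{\aleph_0}=\aleph_1$ holds, then $\langle\mathcal P(\omega_1),\subset_{\mathrm{NS}}\rangle$ embeds, in the same sense, into $\langle\mathcal E^B_{\omega_1},\le_B\rangle$. -/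

import Mathlib

open scoped Cardinal

universe u

/-- The generalized Cantor space `2^κ`: all functions from (the initial ordinal of) `κ` to
`{0, 1}`. It is a type synonym, so it does not carry the product topology. -/
def GenCantor (κ : Cardinal.{u}) : Type u :=
  κ.ord.ToType → Bool

/-- The basic open set `N_p = {η ∈ 2^κ | η ↾ α = p}` for `α < κ` and `p ∈ 2^α`. -/
def GenCantor.basicOpen {κ : Cardinal.{u}} (α : κ.ord.ToType) (p : Set.Iio α → Bool) :
    Set (GenCantor κ) :=
  {η | ∀ i : Set.Iio α, η i = p i}

/-- The topology of `2^κ`, generated by the sets `N_p` (the bounded topology). -/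
instance GenCantor.instTopologicalSpace (κ : Cardinal.{u}) : TopologicalSpace (GenCantor κ) :=
  TopologicalSpace.generateFrom
    {U | ∃ (α : κ.ord.ToType) (p : Set.Iio α → Bool), U = GenCantor.basicOpen α p}

/-- The `κ`-Borel sets of a topological space: the least collection that contains the open sets
and is closed under complements and under unions and intersections of length at most `κ`. -/
inductive IsKappaBorel (κ : Cardinal.{u}) {X : Type u} [TopologicalSpace X] : Set X → Prop
  | isOpen (U : Set X) (hU : IsOpen U) : IsKappaBorel κ U
  | compl (A : Set X) (hA : IsKappaBorel κ A) : IsKappaBorel κ Aᶜ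
  | iUnion (ι : Type u) (hι : #ι ≤ κ) (A : ι → Set X) (hA : ∀ i, IsKappaBorel κ (A i)) :
      IsKappaBorel κ (⋃ i, A i)
  | iInter (ι : Type u) (hι : #ι ≤ κ) (A : ι → Set X) (hA : ∀ i, IsKappaBorel κ (A i)) :
      IsKappaBorel κ (⋂ i, A i)

/-- A function `2^κ → 2^κ` is Borel if inverse images of open sets are Borel. -/
def IsBorelFunction {κ : Cardinal.{u}} (f : GenCantor κ → GenCantor κ) : Prop :=
  ∀ U : Set (GenCantor κ), IsOpen U → IsKappaBorel κ (f ⁻¹' U)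

/-- The collection of Borel equivalence relations on `2^κ`: those equivalence relations
that are Borel subsets of `2^κ × 2^κ` (with the product of the topology of `2^κ` with itself). -/
structure BorelEquivRel (κ : Cardinal.{u}) where
  toSetoid : Setoid (GenCantor κ)
  borel : IsKappaBorel κ {q : GenCantor κ × GenCantor κ | toSetoid.r q.1 q.2}

/-- Borel reducibility of Borel equivalence relations on `2^κ`. -/
def BorelReducible {κ : Cardinal.{u}} (E E' : BorelEquivRel κ) : Prop :=
  ∃ f : GenCantor κ → GenCantor κ, IsBorelFunction f ∧
    ∀ η ξ, E.toSetoid.r η ξ ↔ E'.toSetoid.r (f η) (f ξ)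

/-- `C ⊆ κ` is `μ`-closed (`μ < κ` regular): for every strictly increasing sequence of length `μ`
in `C`, its supremum is in `C`. -/
def IsClosedOfLength {κ : Cardinal.{u}} (μ : Cardinal.{u}) (C : Set κ.ord.ToType) : Prop :=
  ∀ f : μ.ord.ToType → κ.ord.ToType, StrictMono f → (∀ i, f i ∈ C) →
    ∀ b, IsLUB (Set.range f) b → b ∈ C

/-- `C ⊆ κ` is `μ`-cub: `μ`-closed and unbounded. -/
def IsCubOfLength {κ : Cardinal.{u}} (μ : Cardinal.{u}) (C : Set κ.ord.ToType) : Prop :=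
  IsClosedOfLength μ C ∧ IsCofinal C

/-- `S ⊆ κ` is `μ`-stationary: it meets every `μ`-cub set. -/
def IsStationaryOfLength {κ : Cardinal.{u}} (μ : Cardinal.{u}) (S : Set κ.ord.ToType) : Prop :=
  ∀ C : Set κ.ord.ToType, IsCubOfLength μ C → (S ∩ C).Nonempty

/-- `X ⊂_{NS(μ)} Y`: the difference `X \ Y` is not `μ`-stationary. -/
def SubsetNSOfLength (κ μ : Cardinal.{u}) (X Y : Set κ.ord.ToType) : Prop :=
  ¬ IsStationaryOfLength μ (X \ Y)

/-- `X ⊂_{NS} Y`: the difference `X \ Y` is non-stationary. -/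
def SubsetNS (κ : Cardinal.{u}) (X Y : Set κ.ord.ToType) : Prop :=
  ¬ IsStationary (X \ Y)

-- For `S ⊆ κ`, `smallSets S` is a group under symmetric difference; let `E_S` be its orbit
-- relation. Larger `S` means a stricter condition, and for ω-stationary `S` the relation `E_S`
-- reduces to `E_T` exactly when `T \ S` is not ω-stationary. Since `Yᶜ \ Xᶜ = X \ Y`, the map `X ↦
-- E_{Xᶜ}` is then almost the required embedding.
--
-- Positive half (`exists_continuous_reduction`): choose an ω-cub `C` missing `T \ S`. The map
-- copies `x` on `C` and stretches these values over the gaps of `C`. This preserves eventual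
-- constancy at points of `T`: they are either limits of `C`, hence in `S`, or end inside a gap. In
-- the gaps it also codes, cofinally often, the class of `x` at each point of `S`. Here `κ^{<κ} = κ`
-- is needed, to list all bounded sequences.
--
-- Negative half (`not_reduction_of_isStationaryOfLength_diff`): a Borel map is continuous on a
-- comeager set. Build pairs with small difference by finite approximations whose images are forced
-- alternately to differ and to agree. At a limit `α ∈ T \ S` of ω steps the difference is still in
-- `smallSets S`, as `α ∉ S`, but the difference of the images oscillates below `α ∈ T`.
--
-- Two repairs remain. A nonstationary `Xᶜ` is replaced by `∅`, and each relation is conjugated by a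
-- homeomorphism that codes `X`, which makes the map one-to-one.

universe v

/-- `κ` is an uncountable regular cardinal. -/
class UncountableRegular (κ : Cardinal.{u}) : Prop where
  isRegular : κ.IsRegular
  aleph0_lt : ℵ₀ < κ

/-! ### ω-cub and ω-stationary sets in terms of closure points of functions -/

section Index

variable {κ : Cardinal.{u}} [hκ : UncountableRegular κ]

theorem exists_forall_lt_of_mk_lt {ι : Type u} (hι : #ι < κ) (h : ι → κ.ord.ToType) :
    ∃ b, ∀ i, h i < b := by
  have hcof : Order.cof κ.ord.ToType = κ := by
    rw [Ordinal.cof_toType, hκ.isRegular.cof_ord]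
  have hnot : ¬ IsCofinal (Set.range h) := by
    intro hc
    have h1 := Order.cof_le hc
    rw [hcof] at h1
    exact absurd (h1.trans Cardinal.mk_range_le) (not_le.2 hι)
  rw [not_isCofinal_iff] at hnot
  obtain ⟨b, hb⟩ := hnot
  exact ⟨b, fun i => by simpa using hb (h i) ⟨i, rfl⟩⟩

instance : Nonempty κ.ord.ToType := by
  rw [← Cardinal.mk_ne_zero_iff, Cardinal.mk_ord_toType]
  exact hκ.isRegular.ne_zero

instance : NoMaxOrder κ.ord.ToType where
  exists_gt a := by
    have h1 : #PUnit.{u + 1} < κ := by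
      rw [Cardinal.mk_punit]
      exact Cardinal.one_lt_aleph0.trans hκ.aleph0_lt
    obtain ⟨b, hb⟩ := exists_forall_lt_of_mk_lt h1 (fun _ => a)
    exact ⟨b, hb ⟨⟩⟩

omit hκ in
theorem mk_Iio_lt (a : κ.ord.ToType) : #(Set.Iio a) < κ :=
  Cardinal.mk_Iio_toType_ord_lt a

theorem mk_Iic_lt (a : κ.ord.ToType) : #(Set.Iic a) < κ := by
  obtain ⟨b, hb⟩ := exists_gt a
  exact (Cardinal.mk_le_mk_of_subset (Set.Iic_subset_Iio.2 hb)).trans_lt (mk_Iio_lt b)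

theorem exists_forall_lt_of_countable {ι : Type*} [Countable ι] (h : ι → κ.ord.ToType) :
    ∃ b, ∀ i, h i < b := by
  have h1 : #(Set.range h) < κ :=
    (Cardinal.mk_le_aleph0_iff.2 (Set.countable_range h).to_subtype).trans_lt hκ.aleph0_lt
  obtain ⟨b, hb⟩ := exists_forall_lt_of_mk_lt h1 Subtype.val
  exact ⟨b, fun i => hb ⟨h i, i, rfl⟩⟩

omit hκ in
theorem exists_isLUB_of_bddAbove {s : Set κ.ord.ToType} (hs : BddAbove s) : ∃ a, IsLUB s a := by
  obtain ⟨a, ha, hmin⟩ := WellFounded.has_min (wellFounded_lt (α := κ.ord.ToType)) _ hs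
  exact ⟨a, ha, fun b hb => not_lt.1 (hmin b hb)⟩

/-- The points that are suprema of strictly increasing sequences of length `ω`. -/
def omegaLimits (κ : Cardinal.{u}) : Set κ.ord.ToType :=
  {a | ∃ f : ℕ → κ.ord.ToType, StrictMono f ∧ IsLUB (Set.range f) a}

omit hκ in
theorem StrictMono.lt_of_isLUB_range {f : ℕ → κ.ord.ToType} (hf : StrictMono f)
    {a : κ.ord.ToType} (ha : IsLUB (Set.range f) a) (n : ℕ) : f n < a :=
  (hf n.lt_succ_self).trans_le (ha.1 ⟨n + 1, rfl⟩)

omit hκ in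
theorem exists_lt_of_lt_isLUB_range {f : ℕ → κ.ord.ToType}
    {a b : κ.ord.ToType} (ha : IsLUB (Set.range f) a) (hb : b < a) : ∃ n, b < f n := by
  obtain ⟨_, ⟨n, rfl⟩, hn⟩ := (lt_isLUB_iff ha).1 hb
  exact ⟨n, hn⟩

omit hκ in
theorem exists_between_of_mem_omegaLimits {a b : κ.ord.ToType} (ha : a ∈ omegaLimits κ)
    (hb : b < a) : ∃ c, b < c ∧ c < a := by
  obtain ⟨f, hf, hfa⟩ := ha
  obtain ⟨n, hn⟩ := exists_lt_of_lt_isLUB_range hfa hb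
  exact ⟨f n, hn, hf.lt_of_isLUB_range hfa n⟩

/-- The limits of cofinality `ω` that are closed under the function `g`. -/
def closurePoints (g : κ.ord.ToType → κ.ord.ToType) : Set κ.ord.ToType :=
  {a | a ∈ omegaLimits κ ∧ ∀ b < a, g b < a}

theorem exists_mem_closurePoints_gt (g : κ.ord.ToType → κ.ord.ToType) (b : κ.ord.ToType) :
    ∃ a ∈ closurePoints g, b < a := by
  have hstep : ∀ x : κ.ord.ToType, ∃ y, x < y ∧ ∀ i ≤ x, g i < y := by
    intro x
    obtain ⟨y, hy⟩ := exists_forall_lt_of_mk_lt (mk_Iic_lt x) (fun i => g i)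
    exact ⟨max y (Order.succ x), lt_max_of_lt_right (Order.lt_succ x),
      fun i hi => lt_max_of_lt_left (hy ⟨i, hi⟩)⟩
  choose s hs hgs using hstep
  let f : ℕ → κ.ord.ToType := fun n => s^[n] b
  have hf : ∀ n, f (n + 1) = s (f n) := fun n => Function.iterate_succ_apply' s n b
  have hmono : StrictMono f := strictMono_nat_of_lt_succ fun n => by rw [hf]; exact hs _
  obtain ⟨c, hc⟩ := exists_forall_lt_of_countable f
  obtain ⟨a, ha⟩ := exists_isLUB_of_bddAbove (s := Set.range f)
    ⟨c, by rintro _ ⟨n, rfl⟩; exact (hc n).le⟩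
  refine ⟨a, ⟨⟨f, hmono, ha⟩, fun x hx => ?_⟩, hmono.lt_of_isLUB_range ha 0⟩
  obtain ⟨n, hn⟩ := exists_lt_of_lt_isLUB_range ha hx
  exact ((hgs (f n) x hn.le).trans_eq (hf n).symm).trans (hmono.lt_of_isLUB_range ha (n + 1))

omit hκ in
theorem isClosedOfLength_aleph0_iff {C : Set κ.ord.ToType} :
    IsClosedOfLength ℵ₀ C ↔ ∀ f : ℕ → κ.ord.ToType, StrictMono f → (∀ n, f n ∈ C) →
      ∀ b, IsLUB (Set.range f) b → b ∈ C := by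
  have e : Nonempty (ℕ ≃o (ℵ₀ : Cardinal.{u}).ord.ToType) := by
    have h : Ordinal.lift.{u} (Ordinal.type (α := ℕ) (· < ·)) =
        Ordinal.lift.{0} (Ordinal.type (α := (ℵ₀ : Cardinal.{u}).ord.ToType) (· < ·)) := by
      simp
    obtain ⟨e⟩ := Ordinal.lift_type_eq.1 h
    exact ⟨OrderIso.ofRelIsoLT e⟩
  obtain ⟨e⟩ := e
  constructor
  · intro h f hf hfC b hb
    refine h (f ∘ e.symm) (hf.comp e.symm.strictMono) (fun i => hfC _) b ?_
    rwa [e.symm.surjective.range_comp]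
  · intro h f hf hfC b hb
    refine h (f ∘ e) (hf.comp e.strictMono) (fun i => hfC _) b ?_
    rwa [e.surjective.range_comp]

theorem isCubOfLength_closurePoints (g : κ.ord.ToType → κ.ord.ToType) :
    IsCubOfLength ℵ₀ (closurePoints g) := by
  refine ⟨isClosedOfLength_aleph0_iff.2 fun f hf hfC b hb => ⟨⟨f, hf, hb⟩, fun x hx => ?_⟩,
    fun b => ?_⟩
  · obtain ⟨n, hn⟩ := exists_lt_of_lt_isLUB_range hb hx
    exact ((hfC n).2 x hn).trans (hf.lt_of_isLUB_range hb n)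
  · obtain ⟨a, ha, hba⟩ := exists_mem_closurePoints_gt g b
    exact ⟨a, ha, hba.le⟩

/-- Let `g` choose an element of `C` above its argument. A closure point `a` of `g` is the limit of
a sequence that need not lie in `C`, but interleaving it with values of `g` yields a sequence in `C`
with the same supremum. Hence ω-stationarity can be tested on sets `closurePoints g` alone. -/
theorem IsCubOfLength.exists_closurePoints_subset {C : Set κ.ord.ToType}
    (hC : IsCubOfLength ℵ₀ C) : ∃ g, closurePoints g ⊆ C := by
  have hnext : ∀ b, ∃ c ∈ C, b < c := fun b => by
    obtain ⟨c, hc, hbc⟩ := hC.2 (Order.succ b)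
    exact ⟨c, hc, (Order.lt_succ b).trans_le hbc⟩
  choose g hgC hg using hnext
  refine ⟨g, ?_⟩
  rintro a ⟨⟨f, hf, hfa⟩, hga⟩
  let y : ℕ → κ.ord.ToType := fun n => Nat.rec (g (f 0)) (fun n x => g (max x (f (n + 1)))) n
  have hy : ∀ n, y (n + 1) = g (max (y n) (f (n + 1))) := fun n => rfl
  have hfy : ∀ n, f n < y n := by
    intro n
    cases n with
    | zero => exact hg _
    | succ n => rw [hy]; exact (le_max_right _ _).trans_lt (hg _)
  have hya : ∀ n, y n < a := by
    intro n
    induction n with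
    | zero => exact hga _ (hf.lt_of_isLUB_range hfa 0)
    | succ n ih => rw [hy]; exact hga _ (max_lt ih (hf.lt_of_isLUB_range hfa _))
  refine isClosedOfLength_aleph0_iff.1 hC.1 y (strictMono_nat_of_lt_succ fun n => ?_) ?_ a ⟨?_, ?_⟩
  · rw [hy]; exact (le_max_left _ _).trans_lt (hg _)
  · intro n
    cases n <;> exact hgC _
  · rintro _ ⟨n, rfl⟩
    exact (hya n).le
  · intro b hb
    refine hfa.2 ?_
    rintro _ ⟨n, rfl⟩
    exact (hfy n).le.trans (hb ⟨n, rfl⟩)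

theorem isStationaryOfLength_aleph0_iff {A : Set κ.ord.ToType} :
    IsStationaryOfLength ℵ₀ A ↔ ∀ g, ∃ a ∈ A, a ∈ closurePoints g := by
  constructor
  · intro h g
    exact h _ (isCubOfLength_closurePoints g)
  · intro h C hC
    obtain ⟨g, hg⟩ := hC.exists_closurePoints_subset
    obtain ⟨a, ha, hag⟩ := h g
    exact ⟨a, ha, hg hag⟩

theorem IsStationaryOfLength.of_union {A B : Set κ.ord.ToType}
    (h : IsStationaryOfLength ℵ₀ (A ∪ B)) :
    IsStationaryOfLength ℵ₀ A ∨ IsStationaryOfLength ℵ₀ B := by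
  simp only [isStationaryOfLength_aleph0_iff] at *
  by_contra! hcon
  obtain ⟨⟨g, hg⟩, g', hg'⟩ := hcon
  obtain ⟨a, ha, hal, hag⟩ := h fun b => max (g b) (g' b)
  rcases ha with ha | ha
  · exact hg a ha ⟨hal, fun b hb => (le_max_left _ _).trans_lt (hag b hb)⟩
  · exact hg' a ha ⟨hal, fun b hb => (le_max_right _ _).trans_lt (hag b hb)⟩

omit hκ in
theorem IsStationaryOfLength.mono {μ : Cardinal.{u}} {A B : Set κ.ord.ToType}
    (h : IsStationaryOfLength μ A) (hAB : A ⊆ B) : IsStationaryOfLength μ B :=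
  fun C hC => (h C hC).mono (Set.inter_subset_inter_left _ hAB)

end Index

/-! ### The bounded topology through agreement on initial segments -/

section Topology

variable {κ : Cardinal.{u}}

/-- `x` and `y` have the same restriction to `a`. -/
def AgreeBelow (a : κ.ord.ToType) (x y : GenCantor κ) : Prop :=
  ∀ i < a, x i = y i

theorem AgreeBelow.refl (a : κ.ord.ToType) (x : GenCantor κ) : AgreeBelow a x x :=
  fun _ _ => rfl

theorem AgreeBelow.symm {a : κ.ord.ToType} {x y : GenCantor κ} (h : AgreeBelow a x y) :
    AgreeBelow a y x :=
  fun i hi => (h i hi).symm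

theorem AgreeBelow.trans {a : κ.ord.ToType} {x y z : GenCantor κ} (h : AgreeBelow a x y)
    (h' : AgreeBelow a y z) : AgreeBelow a x z :=
  fun i hi => (h i hi).trans (h' i hi)

theorem AgreeBelow.mono {a b : κ.ord.ToType} {x y : GenCantor κ} (h : AgreeBelow b x y)
    (hab : a ≤ b) : AgreeBelow a x y :=
  fun i hi => h i (hi.trans_le hab)

/-- The coordinatewise exclusive or, that is, the symmetric difference. -/
def GenCantor.xor (x y : GenCantor κ) : GenCantor κ :=
  fun i => Bool.xor (x i) (y i)

@[simp]
theorem GenCantor.xor_apply (x y : GenCantor κ) (i : κ.ord.ToType) :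
    x.xor y i = Bool.xor (x i) (y i) :=
  rfl

@[simp]
theorem GenCantor.xor_xor_cancel_right (x y : GenCantor κ) : (x.xor y).xor y = x := by
  funext i
  simp

@[simp]
theorem GenCantor.xor_xor_cancel_left (x y : GenCantor κ) : x.xor (x.xor y) = y := by
  funext i
  simp

theorem AgreeBelow.xor {a : κ.ord.ToType} {x y x' y' : GenCantor κ} (h : AgreeBelow a x y)
    (h' : AgreeBelow a x' y') : AgreeBelow a (x.xor x') (y.xor y') :=
  fun i hi => by simp [h i hi, h' i hi]

theorem GenCantor.isOpen_iff [UncountableRegular κ] {U : Set (GenCantor κ)} :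
    IsOpen U ↔ ∀ x ∈ U, ∃ a, ∀ y, AgreeBelow a x y → y ∈ U := by
  constructor
  · intro hU
    induction hU with
    | basic V hV =>
      obtain ⟨a, p, rfl⟩ := hV
      exact fun x hx => ⟨a, fun y hy i => (hy i i.2).symm.trans (hx i)⟩
    | univ => exact fun x _ => ⟨Classical.arbitrary _, fun _ _ => trivial⟩
    | inter V W _ _ hV hW =>
      intro x hx
      obtain ⟨a, ha⟩ := hV x hx.1
      obtain ⟨b, hb⟩ := hW x hx.2
      exact ⟨max a b, fun y hy =>
        ⟨ha y (hy.mono (le_max_left _ _)), hb y (hy.mono (le_max_right _ _))⟩⟩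
    | sUnion S _ ih =>
      rintro x ⟨V, hVS, hxV⟩
      obtain ⟨a, ha⟩ := ih V hVS x hxV
      exact ⟨a, fun y hy => ⟨V, hVS, ha y hy⟩⟩
  · intro h
    choose! a ha using h
    have hUeq : U = ⋃ x : U, GenCantor.basicOpen (a x) (fun i => (x : GenCantor κ) i) := by
      ext z
      simp only [Set.mem_iUnion]
      constructor
      · exact fun hz => ⟨⟨z, hz⟩, fun _ => rfl⟩
      · rintro ⟨x, hx⟩
        exact ha x x.2 z fun i hi => (hx ⟨i, hi⟩).symm
    rw [hUeq]
    exact isOpen_iUnion fun x => TopologicalSpace.isOpen_generateFrom_of_mem ⟨_, _, rfl⟩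

theorem GenCantor.isOpen_setOf_agreeBelow [UncountableRegular κ] (a : κ.ord.ToType)
    (x : GenCantor κ) : IsOpen {y | AgreeBelow a x y} :=
  isOpen_iff.2 fun _ hy => ⟨a, fun _ hz => AgreeBelow.trans hy hz⟩

theorem GenCantor.continuous_of_forall_exists [UncountableRegular κ]
    {f : GenCantor κ → GenCantor κ}
    (hf : ∀ i, ∃ a, ∀ x y, AgreeBelow a x y → f x i = f y i) : Continuous f := by
  choose a ha using hf
  refine ⟨fun U hU => isOpen_iff.2 fun x hx => ?_⟩
  obtain ⟨b, hb⟩ := isOpen_iff.1 hU _ hx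
  obtain ⟨c, hc⟩ := exists_forall_lt_of_mk_lt (mk_Iio_lt b) (fun i => a i)
  exact ⟨c, fun y hy => hb _ fun i hi => ha i x y (hy.mono (hc ⟨i, hi⟩).le)⟩

theorem GenCantor.isOpen_setOf_apply_eq [UncountableRegular κ] (i : κ.ord.ToType) (v : Bool) :
    IsOpen {x : GenCantor κ | x i = v} := by
  obtain ⟨a, ha⟩ := exists_gt i
  exact isOpen_iff.2 fun x hx => ⟨a, fun y hy => (hy i ha).symm.trans hx⟩

end Topology

/-! ### Closure properties of κ-Borel sets -/

section Borel

variable {κ : Cardinal.{u}} {X Y : Type u} [TopologicalSpace X] [TopologicalSpace Y]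

theorem IsKappaBorel.preimage {A : Set Y} (hA : IsKappaBorel κ A) {f : X → Y}
    (hf : Continuous f) : IsKappaBorel κ (f ⁻¹' A) := by
  induction hA with
  | isOpen U hU => exact .isOpen _ (hU.preimage hf)
  | compl A _ ih => exact .compl _ ih
  | iUnion ι hι A _ ih => rw [Set.preimage_iUnion]; exact .iUnion ι hι _ ih
  | iInter ι hι A _ ih => rw [Set.preimage_iInter]; exact .iInter ι hι _ ih

theorem IsKappaBorel.setOf_exists {ι : Type u} (hι : #ι ≤ κ) {p : ι → X → Prop}
    (hp : ∀ i, IsKappaBorel κ {x | p i x}) : IsKappaBorel κ {x | ∃ i, p i x} := by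
  rw [Set.ofPred_exists]
  exact .iUnion ι hι _ hp

theorem IsKappaBorel.setOf_forall {ι : Type u} (hι : #ι ≤ κ) {p : ι → X → Prop}
    (hp : ∀ i, IsKappaBorel κ {x | p i x}) : IsKappaBorel κ {x | ∀ i, p i x} := by
  rw [Set.ofPred_forall]
  exact .iInter ι hι _ hp

theorem IsKappaBorel.setOf_imp {q : Prop} {p : X → Prop} (hp : IsKappaBorel κ {x | p x}) :
    IsKappaBorel κ {x | q → p x} := by
  by_cases hq : q
  · simpa [hq] using hp
  · simpa [hq] using IsKappaBorel.isOpen (κ := κ) (Set.univ : Set X) isOpen_univ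

theorem IsKappaBorel.setOf_const_and {q : Prop} {p : X → Prop}
    (hp : IsKappaBorel κ {x | p x}) : IsKappaBorel κ {x | q ∧ p x} := by
  by_cases hq : q
  · simpa [hq] using hp
  · simpa [hq] using IsKappaBorel.isOpen (κ := κ) (∅ : Set X) isOpen_empty

theorem IsKappaBorel.setOf_and [UncountableRegular κ] {p q : X → Prop}
    (hp : IsKappaBorel κ {x | p x}) (hq : IsKappaBorel κ {x | q x}) :
    IsKappaBorel κ {x | p x ∧ q x} := by
  have h : {x | p x ∧ q x} = ⋂ b : ULift.{u} Bool, {x | if b.down then p x else q x} := by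
    ext x
    simp [ULift.forall, and_comm]
  rw [h]
  refine .iInter _ ?_ _ ?_
  · exact (Cardinal.mk_le_aleph0).trans (UncountableRegular.aleph0_lt).le
  · rintro ⟨b⟩
    cases b
    · simpa using hq
    · simpa using hp

end Borel

/-! ### Baire category in `2^κ` -/

section Baire

variable {κ : Cardinal.{u}} [hκ : UncountableRegular κ]

/-- Open sets that meet every basic open set. -/
def IsDenseOpen (U : Set (GenCantor κ)) : Prop :=
  IsOpen U ∧ ∀ x a, ∃ y, AgreeBelow a x y ∧ y ∈ U

/-- Sets that contain the intersection of `κ` many dense open sets. -/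
def IsComeager (D : Set (GenCantor κ)) : Prop :=
  ∃ U : κ.ord.ToType → Set (GenCantor κ), (∀ i, IsDenseOpen (U i)) ∧ ⋂ i, U i ⊆ D

theorem IsComeager.iInter {ι : Type u} (hι : #ι ≤ κ) {D : ι → Set (GenCantor κ)}
    (hD : ∀ i, IsComeager (D i)) : IsComeager (⋂ i, D i) := by
  cases isEmpty_or_nonempty ι
  · exact ⟨fun _ => Set.univ, fun _ => ⟨isOpen_univ, fun x a => ⟨x, .refl _ _, trivial⟩⟩, by simp⟩
  choose U hU hUD using hD
  have hcard : #(ι × κ.ord.ToType) ≤ #κ.ord.ToType := by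
    rw [Cardinal.mk_prod, Cardinal.lift_id, Cardinal.lift_id, Cardinal.mk_ord_toType]
    exact (mul_le_mul_left hι κ).trans (Cardinal.mul_eq_self hκ.aleph0_lt.le).le
  obtain ⟨g⟩ := Cardinal.le_def _ _ |>.1 hcard
  have hg : Function.Surjective (Function.invFun g) := Function.invFun_surjective g.injective
  refine ⟨fun k => U (Function.invFun g k).1 (Function.invFun g k).2, fun k => hU _ _, ?_⟩
  refine Set.subset_iInter fun i => Set.Subset.trans ?_ (hUD i)
  refine Set.subset_iInter fun j => ?_
  obtain ⟨k, hk⟩ := hg (i, j)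
  refine (Set.iInter_subset _ k).trans ?_
  rw [hk]

theorem IsComeager.of_isDenseOpen {U : Set (GenCantor κ)} (hU : IsDenseOpen U) :
    IsComeager U :=
  ⟨fun _ => U, fun _ => hU, Set.iInter_subset _ (Classical.arbitrary _)⟩

theorem IsComeager.inter {D D' : Set (GenCantor κ)} (hD : IsComeager D) (hD' : IsComeager D') :
    IsComeager (D ∩ D') := by
  have h : D ∩ D' = ⋂ b : ULift.{u} Bool, if b.down then D else D' := by
    ext x
    simp [ULift.forall, and_comm]
  rw [h]
  refine .iInter ((Cardinal.mk_le_aleph0).trans hκ.aleph0_lt.le) ?_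
  rintro ⟨b⟩
  cases b
  · simpa using hD'
  · simpa using hD

theorem IsComeager.preimage_xor {D : Set (GenCantor κ)} (hD : IsComeager D) (d : GenCantor κ) :
    IsComeager {x | x.xor d ∈ D} := by
  obtain ⟨U, hU, hUD⟩ := hD
  refine ⟨fun i => {x | x.xor d ∈ U i}, fun i => ⟨?_, fun x a => ?_⟩, ?_⟩
  · refine GenCantor.isOpen_iff.2 fun x hx => ?_
    obtain ⟨a, ha⟩ := GenCantor.isOpen_iff.1 (hU i).1 _ hx
    exact ⟨a, fun y hy => ha _ (hy.xor (.refl _ _))⟩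
  · obtain ⟨y, hy, hyU⟩ := (hU i).2 (x.xor d) a
    refine ⟨y.xor d, by simpa using hy.xor (.refl a d), by simpa using hyU⟩
  · intro x hx
    refine hUD (Set.mem_iInter.2 fun i => ?_)
    exact Set.mem_iInter.1 hx i

/-- A common extension of a family of initial segments (if they are coherent). -/
noncomputable def glue {ι : Type*} (F : ι → GenCantor κ × κ.ord.ToType) : GenCantor κ :=
  open Classical in fun i => if h : ∃ j, i < (F j).2 then (F h.choose).1 i else false

omit hκ in
theorem agreeBelow_glue {ι : Type*} {F : ι → GenCantor κ × κ.ord.ToType}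
    (hF : ∀ j j' i, i < (F j).2 → i < (F j').2 → (F j).1 i = (F j').1 i) (j : ι) :
    AgreeBelow (F j).2 (F j).1 (glue F) := by
  intro i hi
  have h : ∃ j, i < (F j).2 := ⟨j, hi⟩
  rw [glue, dif_pos h]
  exact hF _ _ _ hi h.choose_spec

/-- The Baire category theorem for the generalized Cantor space. -/
theorem IsComeager.exists_mem {D : Set (GenCantor κ)} (hD : IsComeager D) (x : GenCantor κ)
    (a : κ.ord.ToType) : ∃ y ∈ D, AgreeBelow a x y := by
  obtain ⟨U, hU, hUD⟩ := hD
  have hstep : ∀ i (p : GenCantor κ × κ.ord.ToType), ∃ q : GenCantor κ × κ.ord.ToType,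
      AgreeBelow p.2 p.1 q.1 ∧ ∀ z, AgreeBelow q.2 q.1 z → z ∈ U i := by
    intro i p
    obtain ⟨y, hy, hyU⟩ := (hU i).2 p.1 p.2
    obtain ⟨b, hb⟩ := GenCantor.isOpen_iff.1 (hU i).1 y hyU
    exact ⟨(y, b), hy, hb⟩
  choose P hP hPU using hstep
  -- `none` stands for the initial condition `(x, a)` and `some j` for stage `j`. Regularity bounds
  -- all earlier heights, so limit stages need no separate treatment.
  have hbound : ∀ (i : κ.ord.ToType) (F : Option (Set.Iio i) → GenCantor κ × κ.ord.ToType),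
      ∃ b, ∀ j, (F j).2 < b := by
    intro i F
    refine exists_forall_lt_of_mk_lt ?_ fun j => (F j).2
    rw [Cardinal.mk_option]
    exact Cardinal.add_lt_of_lt hκ.aleph0_lt.le (mk_Iio_lt i)
      (Cardinal.one_lt_aleph0.trans hκ.aleph0_lt)
  choose B hB using hbound
  let fam : ∀ i : κ.ord.ToType, (∀ j, j < i → GenCantor κ × κ.ord.ToType) →
      Option (Set.Iio i) → GenCantor κ × κ.ord.ToType :=
    fun i G o => o.elim (x, a) fun j => G j j.2
  let z : κ.ord.ToType → GenCantor κ × κ.ord.ToType :=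
    (wellFounded_lt (α := κ.ord.ToType)).fix fun i (G : ∀ j, j < i → GenCantor κ × κ.ord.ToType) =>
      P i (glue (fam i G), B i (fam i G))
  have hz : ∀ i, z i = P i (glue (fam i fun j (_ : j < i) => z j), B i (fam i fun j (_ : j < i) => z j)) :=
    fun i => WellFounded.fix_eq (wellFounded_lt (α := κ.ord.ToType)) _ i
  have key : ∀ i, AgreeBelow a x (z i).1 ∧ ∀ j < i, AgreeBelow (z j).2 (z j).1 (z i).1 := by
    intro i
    induction i using (wellFounded_lt (α := κ.ord.ToType)).induction with
    | h i ih =>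
    have hcoh : ∀ j j' k, k < (fam i (fun j _ => z j) j).2 → k < (fam i (fun j _ => z j) j').2 →
        (fam i (fun j _ => z j) j).1 k = (fam i (fun j _ => z j) j').1 k := by
      intro j j' k hj hj'
      match j, j' with
      | none, none => rfl
      | none, some j' => exact (ih j' j'.2).1 k hj
      | some j, none => exact ((ih j j.2).1 k hj').symm
      | some j, some j' =>
        rcases lt_trichotomy j.1 j'.1 with h | h | h
        · exact (ih j' j'.2).2 j h k hj
        · rw [Subtype.ext h]
        · exact ((ih j j.2).2 j' h k hj').symm
    have hag : ∀ o, AgreeBelow (fam i (fun j _ => z j) o).2 (fam i (fun j _ => z j) o).1 (z i).1 := by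
      intro o
      refine (agreeBelow_glue hcoh o).trans ?_
      rw [hz i]
      exact (hP i (glue (fam i fun j _ => z j), B i (fam i fun j _ => z j))).mono (hB i _ o).le
    exact ⟨hag none, fun j hj => hag (some ⟨j, hj⟩)⟩
  let E : Option κ.ord.ToType → GenCantor κ × κ.ord.ToType := fun o => o.elim (x, a) z
  have hE : ∀ j j' k, k < (E j).2 → k < (E j').2 → (E j).1 k = (E j').1 k := by
    intro j j' k hj hj'
    match j, j' with
    | none, none => rfl
    | none, some j' => exact (key j').1 k hj
    | some j, none => exact ((key j).1 k hj').symm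
    | some j, some j' =>
      rcases lt_trichotomy j j' with h | h | h
      · exact (key j').2 j h k hj
      · rw [h]
      · exact ((key j).2 j' h k hj').symm
  refine ⟨glue E, hUD (Set.mem_iInter.2 fun i => ?_), agreeBelow_glue hE none⟩
  have h := agreeBelow_glue hE (some i)
  change AgreeBelow (z i).2 (z i).1 _ at h
  rw [hz i] at h
  exact hPU i _ _ h

/-- The boundary of an open set is nowhere dense; discarding it makes the set relatively clopen. -/
theorem isDenseOpen_union_interior_compl {W : Set (GenCantor κ)} (hW : IsOpen W) :
    IsDenseOpen (W ∪ interior Wᶜ) := by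
  refine ⟨hW.union isOpen_interior, fun x a => ?_⟩
  by_cases h : ∃ y ∈ W, AgreeBelow a x y
  · obtain ⟨y, hy, hxy⟩ := h
    exact ⟨y, hxy, .inl hy⟩
  · push Not at h
    refine ⟨x, .refl _ _, .inr ?_⟩
    exact mem_interior.2 ⟨{y | AgreeBelow a x y}, fun y hy hyW => h y hyW hy,
      GenCantor.isOpen_setOf_agreeBelow a x, AgreeBelow.refl _ _⟩

/-- Borel sets are relatively clopen in a comeager set. -/
theorem IsKappaBorel.exists_isComeager {A : Set (GenCantor κ)} (hA : IsKappaBorel κ A) :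
    ∃ D, IsComeager D ∧ ∀ x ∈ D, ∃ a, ∀ y ∈ D, AgreeBelow a x y → (y ∈ A ↔ x ∈ A) := by
  have hcompl : ∀ A : Set (GenCantor κ), (∃ D, IsComeager D ∧ ∀ x ∈ D, ∃ a, ∀ y ∈ D,
      AgreeBelow a x y → (y ∈ A ↔ x ∈ A)) → ∃ D, IsComeager D ∧ ∀ x ∈ D, ∃ a, ∀ y ∈ D,
      AgreeBelow a x y → (y ∈ Aᶜ ↔ x ∈ Aᶜ) := by
    rintro A ⟨D, hD, h⟩
    refine ⟨D, hD, fun x hx => ?_⟩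
    obtain ⟨a, ha⟩ := h x hx
    exact ⟨a, fun y hy hxy => not_congr (ha y hy hxy)⟩
  have hunion : ∀ (ι : Type u) (_ : #ι ≤ κ) (A : ι → Set (GenCantor κ)),
      (∀ i, ∃ D, IsComeager D ∧ ∀ x ∈ D, ∃ a, ∀ y ∈ D, AgreeBelow a x y →
        (y ∈ A i ↔ x ∈ A i)) → ∃ D, IsComeager D ∧ ∀ x ∈ D, ∃ a, ∀ y ∈ D,
        AgreeBelow a x y → (y ∈ ⋃ i, A i ↔ x ∈ ⋃ i, A i) := by
    intro ι hι A h
    choose D hD hDA using h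
    -- `W` consists of the points near which some `A i` holds throughout `D i`. On the intersection
    -- of the `D i` it coincides with the union of the `A i`.
    let W : Set (GenCantor κ) := {x | ∃ i a, ∀ y ∈ D i, AgreeBelow a x y → y ∈ A i}
    have hW : IsOpen W := by
      refine GenCantor.isOpen_iff.2 ?_
      rintro x ⟨i, a, ha⟩
      exact ⟨a, fun y hy => ⟨i, a, fun z hz hyz => ha z hz (hy.trans hyz)⟩⟩
    refine ⟨(⋂ i, D i) ∩ (W ∪ interior Wᶜ), (IsComeager.iInter hι hD).inter
      (.of_isDenseOpen (isDenseOpen_union_interior_compl hW)), ?_⟩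
    have hDi : ∀ {y}, y ∈ (⋂ i, D i) ∩ (W ∪ interior Wᶜ) → ∀ i, y ∈ D i :=
      fun hy i => Set.mem_iInter.1 hy.1 i
    rintro x hx
    rcases hx.2 with ⟨i, a, ha⟩ | hxW
    · exact ⟨a, fun y hy hxy => iff_of_true (Set.mem_iUnion.2 ⟨i, ha y (hDi hy i) hxy⟩)
        (Set.mem_iUnion.2 ⟨i, ha x (hDi hx i) (.refl _ _)⟩)⟩
    · obtain ⟨a, ha⟩ := GenCantor.isOpen_iff.1 isOpen_interior x hxW
      have hout : ∀ y ∈ (⋂ i, D i) ∩ (W ∪ interior Wᶜ), y ∈ interior Wᶜ → y ∉ ⋃ i, A i := by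
        intro y hy hyW hyA
        obtain ⟨i, hi⟩ := Set.mem_iUnion.1 hyA
        obtain ⟨b, hb⟩ := hDA i y (hDi hy i)
        exact interior_subset hyW ⟨i, b, fun z hz hyz => (hb z hz hyz).2 hi⟩
      exact ⟨a, fun y hy hxy => iff_of_false (hout y hy (ha y hxy)) (hout x hx hxW)⟩
  induction hA with
  | isOpen U hU =>
    refine ⟨U ∪ interior Uᶜ, .of_isDenseOpen (isDenseOpen_union_interior_compl hU), ?_⟩
    rintro x (hx | hx)
    · obtain ⟨a, ha⟩ := GenCantor.isOpen_iff.1 hU x hx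
      exact ⟨a, fun y _ hxy => iff_of_true (ha y hxy) hx⟩
    · obtain ⟨a, ha⟩ := GenCantor.isOpen_iff.1 isOpen_interior x hx
      exact ⟨a, fun y _ hxy => iff_of_false (interior_subset (ha y hxy)) (interior_subset hx)⟩
  | compl A _ ih => exact hcompl A ih
  | iUnion ι hι A _ ih => exact hunion ι hι A ih
  | iInter ι hι A _ ih =>
    have h := hcompl _ (hunion ι hι _ fun i => hcompl _ (ih i))
    rwa [Set.compl_iUnion, funext fun i => compl_compl (A i)] at h

/-- A Borel function is continuous on a comeager set. -/
theorem IsBorelFunction.exists_isComeager {f : GenCantor κ → GenCantor κ}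
    (hf : IsBorelFunction f) : ∃ D, IsComeager D ∧
      ∀ x ∈ D, ∀ i, ∃ a, ∀ y ∈ D, AgreeBelow a x y → f y i = f x i := by
  choose D hD h using fun i =>
    (hf _ (GenCantor.isOpen_setOf_apply_eq i true)).exists_isComeager
  refine ⟨⋂ i, D i, .iInter (Cardinal.mk_ord_toType κ).le hD, fun x hx i => ?_⟩
  obtain ⟨a, ha⟩ := h i x (Set.mem_iInter.1 hx i)
  refine ⟨a, fun y hy hxy => ?_⟩
  have := ha y (Set.mem_iInter.1 hy i) hxy
  exact Bool.eq_iff_iff.2 this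

end Baire

/-! ### The relations `E_S` and their conjugates -/

section Relation

variable {κ : Cardinal.{u}}

/-- `d` is constant on a final segment of `a`. -/
def EventuallyConstBelow (a : κ.ord.ToType) (d : GenCantor κ) : Prop :=
  ∃ b < a, ∃ v : Bool, ∀ i, b ≤ i → i < a → d i = v

theorem EventuallyConstBelow.xor {a : κ.ord.ToType} {d d' : GenCantor κ}
    (h : EventuallyConstBelow a d) (h' : EventuallyConstBelow a d') :
    EventuallyConstBelow a (d.xor d') := by
  obtain ⟨b, hb, v, hv⟩ := h
  obtain ⟨b', hb', v', hv'⟩ := h'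
  refine ⟨max b b', max_lt hb hb', Bool.xor v v', fun i hi hia => ?_⟩
  rw [GenCantor.xor_apply, hv i ((le_max_left _ _).trans hi) hia,
    hv' i ((le_max_right _ _).trans hi) hia]

theorem EventuallyConstBelow.congr {a : κ.ord.ToType} {d d' : GenCantor κ}
    (h : EventuallyConstBelow a d) (hdd' : AgreeBelow a d d') : EventuallyConstBelow a d' := by
  obtain ⟨b, hb, v, hv⟩ := h
  exact ⟨b, hb, v, fun i hi hia => (hdd' i hia).symm.trans (hv i hi hia)⟩

/-- The bounded sets which contain or omit a final segment of each point of `S` of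
cofinality `ω`. -/
def smallSets (S : Set κ.ord.ToType) : Set (GenCantor κ) :=
  {d | (∃ b, ∀ i, b ≤ i → d i = false) ∧
    ∀ a, a ∈ S ∩ omegaLimits κ → EventuallyConstBelow a d}

theorem xor_mem_smallSets {S : Set κ.ord.ToType} {d d' : GenCantor κ} (h : d ∈ smallSets S)
    (h' : d' ∈ smallSets S) : d.xor d' ∈ smallSets S := by
  obtain ⟨⟨b, hb⟩, h⟩ := h
  obtain ⟨⟨b', hb'⟩, h'⟩ := h'
  refine ⟨⟨max b b', fun i hi => ?_⟩, fun a ha => (h a ha).xor (h' a ha)⟩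
  rw [GenCantor.xor_apply, hb i ((le_max_left _ _).trans hi),
    hb' i ((le_max_right _ _).trans hi), Bool.xor_self]

theorem mem_smallSets_of_forall_eq_false [UncountableRegular κ] {S : Set κ.ord.ToType}
    {d : GenCantor κ} (hd : ∀ i, d i = false) : d ∈ smallSets S := by
  refine ⟨⟨Classical.arbitrary _, fun i _ => hd i⟩, ?_⟩
  rintro a ⟨-, f, hf, hfa⟩
  exact ⟨f 0, hf.lt_of_isLUB_range hfa 0, false, fun i _ _ => hd i⟩

theorem GenCantor.xor_comm (x y : GenCantor κ) : x.xor y = y.xor x := by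
  funext i
  simp [Bool.xor_comm]

theorem GenCantor.xor_xor_xor_cancel (x y z : GenCantor κ) :
    (x.xor y).xor (y.xor z) = x.xor z := by
  funext i
  simp

/-- The orbit equivalence relation of the group `smallSets S`. -/
def smallSetoid [UncountableRegular κ] (S : Set κ.ord.ToType) : Setoid (GenCantor κ) where
  r x y := x.xor y ∈ smallSets S
  iseqv :=
    { refl := fun x => mem_smallSets_of_forall_eq_false fun i => by simp
      symm := fun {x y} h => by rwa [GenCantor.xor_comm]
      trans := fun {x y z} h h' => by
        rw [← GenCantor.xor_xor_xor_cancel x y z]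
        exact xor_mem_smallSets h h' }

theorem isKappaBorel_smallSetoid [UncountableRegular κ] (S : Set κ.ord.ToType) :
    IsKappaBorel κ {q : GenCantor κ × GenCantor κ | (smallSetoid S).r q.1 q.2} := by
  have hK : #κ.ord.ToType ≤ κ := (Cardinal.mk_ord_toType κ).le
  have hB : #(ULift.{u} Bool) ≤ κ :=
    Cardinal.mk_le_aleph0.trans UncountableRegular.aleph0_lt.le
  have hbasic : ∀ (i : κ.ord.ToType) (v : Bool),
      IsKappaBorel κ {q : GenCantor κ × GenCantor κ | q.1.xor q.2 i = v} := by
    intro i v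
    have h : {q : GenCantor κ × GenCantor κ | q.1.xor q.2 i = v} = ⋃ w : Bool,
        (Prod.fst ⁻¹' {x | x i = w} ∩ Prod.snd ⁻¹' {x | x i = Bool.xor w v}) := by
      ext q
      simp only [Set.mem_ofPred_eq, GenCantor.xor_apply, Set.mem_iUnion, Set.mem_inter_iff,
        Set.mem_preimage]
      constructor
      · rintro rfl
        exact ⟨_, rfl, by simp⟩
      · rintro ⟨w, h1, h2⟩
        rw [h1, h2]
        simp
    rw [h]
    exact .isOpen _ (isOpen_iUnion fun w =>
      ((GenCantor.isOpen_setOf_apply_eq i w).preimage continuous_fst).inter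
        ((GenCantor.isOpen_setOf_apply_eq i _).preimage continuous_snd))
  have h : {q : GenCantor κ × GenCantor κ | (smallSetoid S).r q.1 q.2} =
      {q | (∃ b, ∀ i, b ≤ i → q.1.xor q.2 i = false) ∧ ∀ a, a ∈ S ∩ omegaLimits κ →
        ∃ b, b < a ∧ ∃ v : ULift.{u} Bool, ∀ i, b ≤ i → i < a → q.1.xor q.2 i = v.down} := by
    ext q
    exact and_congr_right fun _ => forall₂_congr fun a _ => exists_congr fun b =>
      and_congr_right fun _ => ⟨fun ⟨v, hv⟩ => ⟨⟨v⟩, hv⟩, fun ⟨v, hv⟩ => ⟨v.down, hv⟩⟩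
  rw [h]
  refine .setOf_and (.setOf_exists hK fun b => .setOf_forall hK fun i =>
    .setOf_imp (hbasic i _)) ?_
  exact .setOf_forall hK fun a => .setOf_imp <| .setOf_exists hK fun b => .setOf_const_and <|
    .setOf_exists hB fun v => .setOf_forall hK fun i => .setOf_imp <| .setOf_imp (hbasic i _)

/-- Adding `v` to the sequences that contain `z`. -/
def GenCantor.twist (z : κ.ord.ToType) (v x : GenCantor κ) : GenCantor κ :=
  fun i => Bool.xor (x i) (x z && v i)

theorem GenCantor.twist_twist {z : κ.ord.ToType} {v : GenCantor κ} (hv : v z = false)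
    (x : GenCantor κ) : twist z v (twist z v x) = x := by
  funext i
  simp [twist, hv]

theorem GenCantor.continuous_twist [UncountableRegular κ] (z : κ.ord.ToType)
    (v : GenCantor κ) : Continuous (twist z v) := by
  refine continuous_of_forall_exists fun i => ?_
  obtain ⟨a, ha⟩ := exists_gt (max i z)
  exact ⟨a, fun x y hxy => by
    simp [twist, hxy i ((le_max_left _ _).trans_lt ha), hxy z ((le_max_right _ _).trans_lt ha)]⟩

/-- The relation `smallSetoid S`, conjugated by `GenCantor.twist z v`. -/
def twistedRel [UncountableRegular κ] (z : κ.ord.ToType) (v : GenCantor κ)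
    (S : Set κ.ord.ToType) : BorelEquivRel κ where
  toSetoid := (smallSetoid S).comap (GenCantor.twist z v)
  borel := (isKappaBorel_smallSetoid S).preimage
    ((GenCantor.continuous_twist z v).prodMap (GenCantor.continuous_twist z v))

/-- Twisting is a continuous involution when `v z = false`, so it does not affect reducibility; it
serves only to separate relations that would otherwise coincide. -/
theorem borelReducible_twistedRel_iff [UncountableRegular κ] {z : κ.ord.ToType}
    {v w : GenCantor κ} (hv : v z = false) (hw : w z = false) {S T : Set κ.ord.ToType} :
    BorelReducible (twistedRel z v S) (twistedRel z w T) ↔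
      ∃ f : GenCantor κ → GenCantor κ, IsBorelFunction f ∧
        ∀ x y, x.xor y ∈ smallSets S ↔ (f x).xor (f y) ∈ smallSets T := by
  constructor
  · rintro ⟨f, hf, h⟩
    refine ⟨fun x => .twist z w (f (.twist z v x)), fun U hU => ?_, fun x y => ?_⟩
    · exact (hf _ (hU.preimage (GenCantor.continuous_twist z w))).preimage
        (GenCantor.continuous_twist z v)
    · have := h (.twist z v x) (.twist z v y)
      change (GenCantor.twist z v (.twist z v x)).xor (GenCantor.twist z v (.twist z v y)) ∈
        smallSets S ↔ _ at this
      rwa [GenCantor.twist_twist hv, GenCantor.twist_twist hv] at this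
  · rintro ⟨f, hf, h⟩
    refine ⟨fun x => .twist z w (f (.twist z v x)), fun U hU => ?_, fun x y => ?_⟩
    · exact (hf _ (hU.preimage (GenCantor.continuous_twist z w))).preimage
        (GenCantor.continuous_twist z v)
    · change _ ↔ (GenCantor.twist z w (.twist z w _)).xor (GenCantor.twist z w (.twist z w _)) ∈
        smallSets T
      rw [GenCantor.twist_twist hw, GenCantor.twist_twist hw]
      exact h _ _

end Relation

/-! ### The continuous reduction when `T \ S` is not ω-stationary -/

section Reduction

variable {κ : Cardinal.{u}} [hκ : UncountableRegular κ]

theorem succ_notMem_omegaLimits (a : κ.ord.ToType) :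
    Order.succ a ∉ omegaLimits κ := fun h => by
  obtain ⟨c, hac, hc⟩ := exists_between_of_mem_omegaLimits h (Order.lt_succ a)
  exact absurd (Order.succ_le_of_lt hac) (not_le.2 hc)

/-- Every set of at most `κ` elements has an enumeration with cofinal fibres, even outside of
the limits of cofinality `ω`. -/
theorem exists_enumeration_cofinal_fibres {Q : Type u} [Nonempty Q] (hQ : #Q ≤ κ) :
    ∃ e : κ.ord.ToType → Q, ∀ q b, ∃ i, b ≤ i ∧ i ∉ omegaLimits κ ∧ e i = q := by
  have hcard : #(Q × κ.ord.ToType) ≤ #κ.ord.ToType := by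
    rw [Cardinal.mk_prod, Cardinal.lift_id, Cardinal.lift_id, Cardinal.mk_ord_toType]
    exact (mul_le_mul_left hQ κ).trans (Cardinal.mul_eq_self hκ.aleph0_lt.le).le
  obtain ⟨g⟩ := Cardinal.le_def _ _ |>.1 hcard
  -- Successors are never ω-limits. Each fibre has size `κ`, so it cannot lie inside an initial
  -- segment.
  let j : Q × κ.ord.ToType → κ.ord.ToType := fun p => Order.succ (g p)
  have hj : Function.Injective j := fun p p' h => g.injective (Order.succ_injective h)
  refine ⟨fun i => (Function.invFun j i).1, fun q b => ?_⟩
  by_contra! hcon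
  have hlt : ∀ k, j (q, k) < b := by
    intro k
    by_contra! hk
    exact hcon _ hk (succ_notMem_omegaLimits _) (by rw [Function.leftInverse_invFun hj])
  have hle : #κ.ord.ToType ≤ #(Set.Iio b) :=
    Cardinal.mk_le_of_injective (f := fun k => (⟨j (q, k), hlt k⟩ : Set.Iio b))
      fun k k' h => (Prod.ext_iff.1 (hj (Subtype.ext_iff.1 h))).2
  rw [Cardinal.mk_ord_toType] at hle
  exact absurd (mk_Iio_lt b) (not_lt.2 hle)

omit hκ in
theorem mk_bounded_sequences_le (hpow : κ ^< κ = κ) (h0 : ℵ₀ < κ) :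
    #(Σ a : κ.ord.ToType, (Set.Iio a → Bool)) ≤ κ := by
  rw [Cardinal.mk_sigma]
  refine (Cardinal.sum_le_sum _ (fun _ => κ) fun a => ?_).trans ?_
  · have h2 : (2 : Cardinal.{u}) ≤ κ := (Cardinal.natCast_le_aleph0 (n := 2)).trans h0.le
    rw [Cardinal.mk_arrow, Cardinal.mk_bool, Cardinal.lift_ofNat, Cardinal.lift_uzero]
    exact (Cardinal.power_le_power_right h2).trans
      ((Cardinal.le_powerlt κ (mk_Iio_lt a)).trans hpow.le)
  · rw [Cardinal.sum_const, Cardinal.lift_id, Cardinal.lift_id, Cardinal.mk_ord_toType]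
    exact (Cardinal.mul_eq_self h0.le).le

/-- If `d` is neither bounded nor cobounded, then neither is its trace on `ω`-club many
initial segments. -/
theorem IsStationaryOfLength.exists_bound {S : Set κ.ord.ToType}
    (hS : IsStationaryOfLength ℵ₀ S) {d : GenCantor κ}
    (hd : ∀ a, a ∈ S ∩ omegaLimits κ → EventuallyConstBelow a d) :
    ∃ b v, ∀ i, b ≤ i → d i = v := by
  by_contra! hcon
  choose g hg hgv using hcon
  obtain ⟨a, haS, ha, hga⟩ := isStationaryOfLength_aleph0_iff.1 hS
    fun b => max (g b false) (g b true)
  obtain ⟨b, hb, v, hv⟩ := hd a ⟨haS, ha⟩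
  have hlt := hga b hb
  rw [max_lt_iff] at hlt
  cases v
  · exact hgv b false (hv _ (hg b false) hlt.1)
  · exact hgv b true (hv _ (hg b true) hlt.2)

/-- The extension of a bounded sequence by zeros. -/
noncomputable def extendByFalse {a : κ.ord.ToType} (p : Set.Iio a → Bool) : GenCantor κ :=
  open Classical in fun i => if h : i < a then p ⟨i, h⟩ else false

theorem exists_continuous_reduction (hpow : κ ^< κ = κ) {S T : Set κ.ord.ToType}
    (hS : IsStationaryOfLength ℵ₀ S) (hTS : ¬ IsStationaryOfLength ℵ₀ (T \ S)) :
    ∃ f : GenCantor κ → GenCantor κ, Continuous f ∧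
      ∀ x y, x.xor y ∈ smallSets S ↔ (f x).xor (f y) ∈ smallSets T := by
  classical
  rw [isStationaryOfLength_aleph0_iff] at hTS
  push Not at hTS
  obtain ⟨g, hg⟩ := hTS
  set C := closurePoints g
  have hCT : ∀ a ∈ C, a ∈ T → a ∈ S := fun a haC haT => by
    by_contra haS
    exact hg a ⟨haT, haS⟩ haC
  have hCω : ∀ a ∈ C, a ∈ omegaLimits κ := fun a ha => ha.1
  have hnext : ∀ i : κ.ord.ToType, ∃ c ∈ C, i ≤ c ∧ ∀ c' ∈ C, i ≤ c' → c ≤ c' := by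
    intro i
    obtain ⟨c, hc, hic⟩ := exists_mem_closurePoints_gt g i
    obtain ⟨m, hm, hmin⟩ := (wellFounded_lt (α := κ.ord.ToType)).has_min {c | c ∈ C ∧ i ≤ c}
      ⟨c, hc, hic.le⟩
    exact ⟨m, hm.1, hm.2, fun c' hc' hic' => not_lt.1 (hmin c' ⟨hc', hic'⟩)⟩
  choose c hcC hic hcmin using hnext
  have hcc : ∀ i ∈ C, c i = i := fun i hi => (hcmin i i hi le_rfl).antisymm (hic i)
  have hQ : Nonempty (Σ a : κ.ord.ToType, (Set.Iio a → Bool)) :=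
    ⟨⟨Classical.arbitrary _, fun _ => false⟩⟩
  obtain ⟨e, he⟩ := exists_enumeration_cofinal_fibres (mk_bounded_sequences_le hpow hκ.aleph0_lt)
  -- `G x` records, for each bounded sequence `e i` of length in `S ∩ omegaLimits κ`, whether `x` is
  -- equivalent to it at that length; `c i` is the least element of `C` from `i` on.
  let G : GenCantor κ → GenCantor κ := fun x i =>
    decide ((e i).1 ∈ S ∩ omegaLimits κ ∧ EventuallyConstBelow (e i).1 (x.xor (extendByFalse (e i).2)))
  let f : GenCantor κ → GenCantor κ := fun x i =>
    if i ∈ C then x i else Bool.xor (x (c i)) (G x i)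
  have hfx : ∀ x y i, (f x).xor (f y) i =
      Bool.xor (x.xor y (c i)) (if i ∈ C then false else Bool.xor (G x i) (G y i)) := by
    intro x y i
    rw [GenCantor.xor_apply]
    by_cases hi : i ∈ C
    · simp [f, hi, hcc i hi]
    · simp only [f, hi, if_false, GenCantor.xor_apply]
      cases x (c i) <;> cases y (c i) <;> cases G x i <;> cases G y i <;> rfl
  refine ⟨f, GenCantor.continuous_of_forall_exists fun i => ?_, fun x y => ⟨fun h => ?_, fun h => ?_⟩⟩
  · obtain ⟨a, ha⟩ := exists_gt (max (c i) (e i).1)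
    refine ⟨a, fun x y hxy => ?_⟩
    have h1 : x (c i) = y (c i) := hxy _ ((le_max_left _ _).trans_lt ha)
    have hG : G x i = G y i := by
      have hag : AgreeBelow (e i).1 (x.xor (extendByFalse (e i).2))
          (y.xor (extendByFalse (e i).2)) :=
        (hxy.mono ((le_max_right _ _).trans ha.le)).xor (.refl _ _)
      exact decide_eq_decide.2 (and_congr_right fun _ => ⟨fun h => h.congr hag,
        fun h => h.congr hag.symm⟩)
    by_cases hi : i ∈ C
    · rw [hcc i hi] at h1
      simp [f, hi, h1]
    · simp [f, hi, h1, hG]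
  · have hG : ∀ i, G x i = G y i := by
      intro i
      refine decide_eq_decide.2 (and_congr_right fun ha => ?_)
      have hxy := h.2 _ ha
      constructor
      · intro hx
        have := hxy.xor hx
        rwa [GenCantor.xor_comm x y, GenCantor.xor_xor_xor_cancel] at this
      · intro hy
        have := hxy.xor hy
        rwa [GenCantor.xor_xor_xor_cancel] at this
    have hfc : ∀ i, (f x).xor (f y) i = x.xor y (c i) := by
      intro i
      rw [hfx, hG]
      simp
    obtain ⟨⟨b, hb⟩, hconst⟩ := h
    refine ⟨⟨b, fun i hi => by rw [hfc]; exact hb _ (hi.trans (hic i))⟩, ?_⟩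
    rintro a ⟨haT, haω⟩
    -- If `C` is bounded below `a`, then `c` is constant on a final segment of `a`. Otherwise `a ∈ C
    -- ∩ T ⊆ S`, and `c` maps final segments of `a` into themselves.
    by_cases hCa : ∃ b < a, ∀ c' ∈ C, b ≤ c' → a ≤ c'
    · obtain ⟨b, hba, hb⟩ := hCa
      refine ⟨b, hba, x.xor y (c b), fun i hbi hia => ?_⟩
      rw [hfc]
      congr 1
      refine le_antisymm (hcmin _ _ (hcC b) ?_) (hcmin _ _ (hcC i) (hbi.trans (hic i)))
      exact hia.le.trans (hb _ (hcC b) (hic b))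
    · push Not at hCa
      have haC : a ∈ C := ⟨haω, fun b hb => by
        obtain ⟨b', hb', hb'a⟩ := exists_between_of_mem_omegaLimits haω hb
        obtain ⟨c', hc', hbc', hca⟩ := hCa b' hb'a
        exact (hc'.2 b (hb'.trans_le hbc')).trans hca⟩
      obtain ⟨b, hba, v, hv⟩ := hconst a ⟨hCT a haC haT, haω⟩
      refine ⟨b, hba, v, fun i hbi hia => ?_⟩
      obtain ⟨c', hc', hic', hc'a⟩ := hCa i hia
      rw [hfc]
      exact hv _ (hbi.trans (hic i)) ((hcmin i c' hc' hic').trans_lt hc'a)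
  · obtain ⟨⟨b, hb⟩, -⟩ := h
    have hDC : ∀ a ∈ C, b ≤ a → x.xor y a = false := by
      intro a haC hba
      have := hb a hba
      rwa [hfx, if_pos haC, hcc a haC, Bool.xor_false] at this
    have hconst : ∀ a, a ∈ S ∩ omegaLimits κ → EventuallyConstBelow a (x.xor y) := by
      intro a ha
      -- The restriction of `x` to `a` is listed beyond the bound `b` and outside `C`, where `f x`
      -- and `f y` agree. So `G x i = G y i`, and `G x i` is true because `x` is equivalent to
      -- itself.
      obtain ⟨i, hbi, hi, hei⟩ := he ⟨a, fun j => x j⟩ b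
      have hiC : i ∉ C := fun h => hi (hCω i h)
      have h1 := hb i hbi
      rw [hfx, hDC _ (hcC i) (hbi.trans (hic i)), if_neg hiC, Bool.false_xor] at h1
      have hext : AgreeBelow a (extendByFalse fun j : Set.Iio a => x j) x := by
        intro j hj
        simp [extendByFalse, hj]
      have hx : G x i = true := by
        refine decide_eq_true ?_
        rw [hei]
        refine ⟨ha, ?_⟩
        have h0 := (mem_smallSets_of_forall_eq_false (S := S) (d := x.xor x) (by simp)).2 a ha
        exact h0.congr ((AgreeBelow.refl a x).xor hext.symm)
      have hy : G y i = true := by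
        rw [hx] at h1
        simpa using h1
      have hy' := of_decide_eq_true hy
      rw [hei] at hy'
      rw [GenCantor.xor_comm]
      exact hy'.2.congr ((AgreeBelow.refl a y).xor hext)
    refine ⟨?_, hconst⟩
    -- Stationarity of `S` makes `x.xor y` constant on a final segment of `κ`; the constant is
    -- `false` because `x` and `y` agree on a tail of `C`.
    obtain ⟨b', v, hv⟩ := hS.exists_bound hconst
    refine ⟨b', fun i hi => ?_⟩
    have h1 : b' ≤ c (max b b') := (le_max_right _ _).trans (hic _)
    have h2 : b ≤ c (max b b') := (le_max_left _ _).trans (hic _)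
    rw [hv i hi, ← hv _ h1, hDC _ (hcC _) h2]

end Reduction

/-! ### No Borel reduction when `T \ S` is ω-stationary -/

section Irreducibility

variable {κ : Cardinal.{u}}

/-- An approximation to a pair of sequences `x`, `x.xor d`: only their restrictions to `height`
matter, and they are meant to decide the values of a function below `imageHeight`. -/
structure PairApprox (κ : Cardinal.{u}) where
  fst : GenCantor κ
  diff : GenCantor κ
  height : κ.ord.ToType
  imageHeight : κ.ord.ToType

/-- The pairs of elements of `D` that extend the approximation. -/
def PairApprox.Extends (p : PairApprox κ) (D : Set (GenCantor κ)) (y y' : GenCantor κ) : Prop :=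
  y ∈ D ∧ y' ∈ D ∧ AgreeBelow p.height p.fst y ∧ AgreeBelow p.height (p.fst.xor p.diff) y'

/-- The approximation has a difference in `smallSets S`, and it decides the values of `f` on `D`
below its image height. -/
structure PairApprox.Decides (p : PairApprox κ) (S : Set κ.ord.ToType) (D : Set (GenCantor κ))
    (f : GenCantor κ → GenCantor κ) : Prop where
  diff_mem : p.diff ∈ smallSets S
  diff_eq_false : ∀ i, p.height ≤ i → p.diff i = false
  agreeBelow : ∀ y y' z z', p.Extends D y y' → p.Extends D z z' →
    AgreeBelow p.imageHeight (f y) (f z) ∧ AgreeBelow p.imageHeight (f y') (f z')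

variable [hκ : UncountableRegular κ] {S T : Set κ.ord.ToType} {D : Set (GenCantor κ)}
  {f : GenCantor κ → GenCantor κ}

theorem exists_agreeBelow_image
    (hf : ∀ x ∈ D, ∀ i, ∃ a, ∀ y ∈ D, AgreeBelow a x y → f y i = f x i)
    {x : GenCantor κ} (hx : x ∈ D) (c : κ.ord.ToType) :
    ∃ a, ∀ y ∈ D, AgreeBelow a x y → AgreeBelow c (f x) (f y) := by
  choose a ha using hf x hx
  obtain ⟨b, hb⟩ := exists_forall_lt_of_mk_lt (mk_Iio_lt c) (fun i => a i)
  exact ⟨b, fun y hy hxy i hi => (ha i y hy (hxy.mono (hb ⟨i, hi⟩).le)).symm⟩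

theorem exists_pair_mem (hD : IsComeager D) (x d : GenCantor κ) (a : κ.ord.ToType) :
    ∃ y ∈ D, y.xor d ∈ D ∧ AgreeBelow a x y := by
  obtain ⟨y, hy, hxy⟩ := (hD.inter (hD.preimage_xor d)).exists_mem x a
  exact ⟨y, hy.1, hy.2, hxy⟩

/-- As `d` is small, the images of `x` and `x.xor d` agree from some `β` on. Continuity on `D` lets
a long enough initial segment of the pair force their values up to a place beyond both `β` and `t`.
-/
theorem exists_decides
    (hf : ∀ x ∈ D, ∀ i, ∃ a, ∀ y ∈ D, AgreeBelow a x y → f y i = f x i)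
    (hST : ∀ x y, x.xor y ∈ smallSets S ↔ (f x).xor (f y) ∈ smallSets T)
    {x d : GenCantor κ} {a : κ.ord.ToType} (hx : x ∈ D) (hxd : x.xor d ∈ D)
    (hd : d ∈ smallSets S) (hda : ∀ i, a ≤ i → d i = false) (t : κ.ord.ToType) :
    ∃ p : PairApprox κ, p.Decides S D f ∧ p.fst = x ∧ p.diff = d ∧ a ≤ p.height ∧
      t < p.height ∧ t < p.imageHeight ∧
      ∃ b, t ≤ b ∧ b < p.imageHeight ∧ ∀ y y', p.Extends D y y' → f y b = f y' b := by
  obtain ⟨⟨β, hβ⟩, -⟩ := (hST x (x.xor d)).1 (by simpa using hd)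
  set b := max β t
  obtain ⟨c, hc⟩ := exists_gt b
  obtain ⟨a₁, ha₁⟩ := exists_agreeBelow_image hf hx c
  obtain ⟨a₂, ha₂⟩ := exists_agreeBelow_image hf hxd c
  obtain ⟨a₃, ha₃⟩ := exists_gt (max (max a t) (max a₁ a₂))
  simp only [max_lt_iff] at ha₃
  obtain ⟨⟨h1, h2⟩, h3, h4⟩ := ha₃
  have hext : ∀ y y', PairApprox.Extends ⟨x, d, a₃, c⟩ D y y' →
      AgreeBelow c (f x) (f y) ∧ AgreeBelow c (f (x.xor d)) (f y') := fun y y' h =>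
    ⟨ha₁ y h.1 (h.2.2.1.mono h3.le), ha₂ y' h.2.1 (h.2.2.2.mono h4.le)⟩
  refine ⟨⟨x, d, a₃, c⟩, ⟨hd, fun i hi => hda i (h1.le.trans hi), fun y y' z z' h h' => ?_⟩,
    rfl, rfl, h1.le, h2, (le_max_right _ _).trans_lt hc, b, le_max_right _ _, hc,
    fun y y' h => ?_⟩
  · exact ⟨(hext y y' h).1.symm.trans (hext z z' h').1,
      (hext y y' h).2.symm.trans (hext z z' h').2⟩
  · have h0 := hβ b (le_max_left _ _)
    replace h0 : f x b = f (x.xor d) b := by simpa using h0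
    rw [← (hext y y' h).1 b hc, ← (hext y y' h).2 b hc, h0]

/-- The approximation `q` extends `p`, it forces a new difference between the images, and it forces
the images to agree at a place above `t`. -/
structure PairApprox.Step (p q : PairApprox κ) (D : Set (GenCantor κ))
    (f : GenCantor κ → GenCantor κ) (t : κ.ord.ToType) : Prop where
  height_le : p.height ≤ q.height
  lt_height : t < q.height
  lt_imageHeight : t < q.imageHeight
  agreeBelow_fst : AgreeBelow p.height p.fst q.fst
  agreeBelow_diff : AgreeBelow p.height p.diff q.diff
  exists_ne : ∃ i, p.imageHeight ≤ i ∧ i < q.imageHeight ∧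
    ∀ y y', q.Extends D y y' → f y i ≠ f y' i
  exists_eq : ∃ i, t ≤ i ∧ i < q.imageHeight ∧ ∀ y y', q.Extends D y y' → f y i = f y' i

/-- Prolonging the difference by ones all the way makes it unbounded, so the images become
inequivalent and must differ above the decided part. An initial segment already forces this new
difference; cutting the ones off there makes the difference small again, and `exists_decides` then
supplies a place of agreement. -/
theorem PairApprox.Decides.exists_step {p : PairApprox κ} (hp : p.Decides S D f)
    (hD : IsComeager D)
    (hf : ∀ x ∈ D, ∀ i, ∃ a, ∀ y ∈ D, AgreeBelow a x y → f y i = f x i)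
    (hST : ∀ x y, x.xor y ∈ smallSets S ↔ (f x).xor (f y) ∈ smallSets T)
    (t : κ.ord.ToType) : ∃ q : PairApprox κ, q.Decides S D f ∧ p.Step q D f t := by
  classical
  obtain ⟨x, d, a, c⟩ := p
  let d₁ : GenCantor κ := fun i => if i < a then d i else true
  have hdd₁ : AgreeBelow a d d₁ := fun i hi => by simp [d₁, hi]
  have hd₁a : ∀ i, a ≤ i → d₁ i = true := fun i hi => by simp [d₁, not_lt.2 hi]
  obtain ⟨y, hy, hyd₁, hxy⟩ := exists_pair_mem hD x d₁ a
  have hext : PairApprox.Extends ⟨x, d, a, c⟩ D y (y.xor d₁) := ⟨hy, hyd₁, hxy, hxy.xor hdd₁⟩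
  have hδ : ∃ δ, c ≤ δ ∧ f y δ ≠ f (y.xor d₁) δ := by
    by_contra! hcon
    have hsmall : (f y).xor (f (y.xor d₁)) ∈ smallSets T := by
      have hzero : ∀ i, c ≤ i → (f y).xor (f (y.xor d₁)) i = false := fun i hi => by
        simp [hcon i hi]
      refine ⟨⟨c, hzero⟩, fun α hα => ?_⟩
      rcases lt_or_ge c α with hcα | hαc
      · exact ⟨c, hcα, false, fun i hi _ => hzero i hi⟩
      -- At or below `c` the images are already decided, so they can be compared with those of a
      -- pair whose difference is the small `d`; that pair has equivalent images.
      · obtain ⟨z, hz, hzd, hxz⟩ := exists_pair_mem hD x d a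
        have hzext : PairApprox.Extends ⟨x, d, a, c⟩ D z (z.xor d) :=
          ⟨hz, hzd, hxz, hxz.xor (.refl _ _)⟩
        have h1 := ((hST z (z.xor d)).1 (by simpa using hp.diff_mem)).2 α hα
        obtain ⟨h2, h3⟩ := hp.agreeBelow _ _ _ _ hzext hext
        exact h1.congr ((h2.mono hαc).xor (h3.mono hαc))
    have h := (hST y (y.xor d₁)).2 hsmall
    rw [GenCantor.xor_xor_cancel_left] at h
    obtain ⟨⟨b, hb⟩, -⟩ := h
    have h1 := hb (max a b) (le_max_right _ _)
    rw [hd₁a _ (le_max_left _ _)] at h1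
    exact Bool.noConfusion h1
  obtain ⟨δ, hcδ, hδ⟩ := hδ
  obtain ⟨a₁, ha₁⟩ := hf y hy δ
  obtain ⟨a₂, ha₂⟩ := hf _ hyd₁ δ
  let a₃ := max a (max a₁ a₂)
  have haa₃ : a ≤ a₃ := le_max_left _ _
  have ha₁₃ : a₁ ≤ a₃ := (le_max_left _ _).trans (le_max_right _ _)
  have ha₂₃ : a₂ ≤ a₃ := (le_max_right _ _).trans (le_max_right _ _)
  let d₂ : GenCantor κ := fun i => if i < a₃ then d₁ i else false
  have hd₁₂ : AgreeBelow a₃ d₁ d₂ := fun i hi => by simp [d₂, hi]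
  have hd₂a : ∀ i, a₃ ≤ i → d₂ i = false := fun i hi => by simp [d₂, not_lt.2 hi]
  have hd₂ : d₂ ∈ smallSets S := by
    refine ⟨⟨a₃, hd₂a⟩, fun α hα => ?_⟩
    rcases lt_or_ge a₃ α with h | h
    · exact ⟨a₃, h, false, fun i hi _ => hd₂a i hi⟩
    -- The added block of ones is an interval, so it is constant near every limit inside it and does
    -- not disturb smallness.
    · rcases lt_or_ge a α with h' | h'
      · exact ⟨a, h', true, fun i hi hiα => by rw [← hd₁₂ i (hiα.trans_le h), hd₁a i hi]⟩
      · exact (hp.diff_mem.2 α hα).congr ((hdd₁.trans (hd₁₂.mono haa₃)).mono h')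
  obtain ⟨z, hz, hzd, hyz⟩ := exists_pair_mem hD y d₂ a₃
  clear_value d₂
  obtain ⟨q, hq, rfl, rfl, haq, htq, htq', b, htb, hbq, hb⟩ :=
    exists_decides hf hST hz hzd hd₂ hd₂a (max t δ)
  refine ⟨q, hq, haa₃.trans haq, (le_max_left _ _).trans_lt htq, (le_max_left _ _).trans_lt htq',
    hxy.trans (hyz.mono haa₃), hdd₁.trans (hd₁₂.mono haa₃),
    ⟨δ, hcδ, (le_max_right _ _).trans_lt htq', fun w w' h => ?_⟩,
    ⟨b, (le_max_left _ _).trans htb, hbq, hb⟩⟩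
  obtain ⟨hw, hw', hqw, hqw'⟩ := h
  rw [ha₁ w hw ((hyz.trans (hqw.mono haq)).mono ha₁₃),
    ha₂ w' hw' (((hyz.xor hd₁₂).trans (hqw'.mono haq)).mono ha₂₃)]
  exact hδ

theorem not_reduction_of_isStationaryOfLength_diff
    (hTS : IsStationaryOfLength ℵ₀ (T \ S)) (hf : IsBorelFunction f) :
    ¬ ∀ x y, x.xor y ∈ smallSets S ↔ (f x).xor (f y) ∈ smallSets T := by
  intro hST
  obtain ⟨D, hD, hfD⟩ := hf.exists_isComeager
  have hinit : ∃ p : PairApprox κ, p.Decides S D f := by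
    obtain ⟨y, hy, hyd, -⟩ := exists_pair_mem hD (fun _ => false) (fun _ => false)
      (Classical.arbitrary κ.ord.ToType)
    obtain ⟨p, hp, -⟩ := exists_decides hfD hST hy hyd
      (mem_smallSets_of_forall_eq_false fun _ => rfl) (a := Classical.arbitrary _)
      (fun _ _ => rfl) (Classical.arbitrary _)
    exact ⟨p, hp⟩
  obtain ⟨p₀, hp₀⟩ := hinit
  choose next hnext hstep using fun (p : {p : PairApprox κ // p.Decides S D f}) t =>
    p.2.exists_step hD hfD hST t
  -- The sequence converging to `α` is known only once `α` is chosen, so approximations are built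
  -- along all finite lists of targets. Fewer than `κ` lists have entries at most `b`, which gives
  -- the function `g` under which `α` must be closed.
  let st : List κ.ord.ToType → {p : PairApprox κ // p.Decides S D f} := fun l =>
    l.foldr (fun t p => ⟨next p t, hnext p t⟩) ⟨p₀, hp₀⟩
  have hst : ∀ t l, (st l).1.Step (st (t :: l)).1 D f t := fun t l => hstep (st l) t
  have hbound : ∀ b : κ.ord.ToType, ∃ c, ∀ l : List κ.ord.ToType, (∀ i ∈ l, i ≤ b) →
      (st l).1.height < c ∧ (st l).1.imageHeight < c := by
    intro b
    have hcard : #(List (Set.Iic b)) < κ :=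
      (Cardinal.mk_list_le_max _).trans_lt (max_lt hκ.aleph0_lt (mk_Iic_lt b))
    obtain ⟨c, hc⟩ := exists_forall_lt_of_mk_lt hcard fun l =>
      max (st (l.map Subtype.val)).1.height (st (l.map Subtype.val)).1.imageHeight
    refine ⟨c, fun l hl => ?_⟩
    have hmem : l ∈ Set.range (List.map ((↑) : Set.Iic b → κ.ord.ToType)) := by
      rw [Set.range_list_map_coe]
      exact hl
    obtain ⟨l, rfl⟩ := hmem
    exact max_lt_iff.1 (hc l)
  choose g hg using hbound
  obtain ⟨α, ⟨hαT, hαS⟩, ⟨s, hs, hsα⟩, hgα⟩ := isStationaryOfLength_aleph0_iff.1 hTS g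
  have hsα' : ∀ n, s n < α := hs.lt_of_isLUB_range hsα
  let l : ℕ → List κ.ord.ToType := fun n => Nat.rec [] (fun n l => s n :: l) n
  have hl : ∀ n, ∀ i ∈ l n, i ≤ s n := by
    intro n
    induction n with
    | zero => simp [l]
    | succ n ih =>
      intro i hi
      rcases List.mem_cons.1 hi with rfl | hi
      · exact (hs n.lt_succ_self).le
      · exact (ih i hi).trans (hs n.lt_succ_self).le
  let p : ℕ → PairApprox κ := fun n => (st (l n)).1
  have hp : ∀ n, (p n).Decides S D f := fun n => (st (l n)).2
  have hpstep : ∀ n, (p n).Step (p (n + 1)) D f (s n) := fun n => hst (s n) (l n)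
  have hheight : ∀ n, (p n).height < α := fun n =>
    (hg (s n) (l n) (hl n)).1.trans (hgα _ (hsα' n))
  have himage : ∀ n, (p n).imageHeight < α := fun n =>
    (hg (s n) (l n) (hl n)).2.trans (hgα _ (hsα' n))
  have hmono : Monotone fun n => (p n).height := monotone_nat_of_le_succ fun n =>
    (hpstep n).height_le
  have hagree : ∀ n k, AgreeBelow (p n).height (p n).fst (p (n + k)).fst ∧
      AgreeBelow (p n).height (p n).diff (p (n + k)).diff := by
    intro n k
    induction k with
    | zero => exact ⟨.refl _ _, .refl _ _⟩
    | succ k ih =>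
      have h := hmono (Nat.le_add_right n k)
      exact ⟨ih.1.trans ((hpstep (n + k)).agreeBelow_fst.mono h),
        ih.2.trans ((hpstep (n + k)).agreeBelow_diff.mono h)⟩
  have hcoh : ∀ m n i, i < (p m).height → i < (p n).height →
      (p m).fst i = (p n).fst i ∧ (p m).diff i = (p n).diff i := by
    intro m n i hm hn
    rcases le_total m n with h | h
    · obtain ⟨k, rfl⟩ := Nat.exists_eq_add_of_le h
      exact ⟨(hagree m k).1 i hm, (hagree m k).2 i hm⟩
    · obtain ⟨k, rfl⟩ := Nat.exists_eq_add_of_le h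
      exact ⟨((hagree n k).1 i hn).symm, ((hagree n k).2 i hn).symm⟩
  let x := glue fun n => ((p n).fst, (p n).height)
  let d := glue fun n => ((p n).diff, (p n).height)
  have hx : ∀ n, AgreeBelow (p n).height (p n).fst x := fun n =>
    agreeBelow_glue (F := fun n => ((p n).fst, (p n).height))
      (fun m n i hm hn => (hcoh m n i hm hn).1) n
  have hd : ∀ n, AgreeBelow (p n).height (p n).diff d := fun n =>
    agreeBelow_glue (F := fun n => ((p n).diff, (p n).height))
      (fun m n i hm hn => (hcoh m n i hm hn).2) n
  have hdα : ∀ i, α ≤ i → d i = false := by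
    intro i hi
    refine dif_neg ?_
    rintro ⟨n, hn⟩
    exact absurd (hi.trans_lt hn) (not_lt.2 (hheight n).le)
  have hdS : d ∈ smallSets S := by
    refine ⟨⟨α, hdα⟩, fun β hβ => ?_⟩
    -- Below `α` some approximation already settles the matter, above it `d` vanishes, and `α`
    -- itself imposes no condition because `α ∉ S`.
    rcases lt_trichotomy β α with h | rfl | h
    · obtain ⟨n, hn⟩ := exists_lt_of_lt_isLUB_range hsα h
      exact ((hp (n + 1)).diff_mem.2 β hβ).congr
        ((hd (n + 1)).mono (hn.trans (hpstep n).lt_height).le)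
    · exact absurd hβ.1 hαS
    · exact ⟨α, h, false, fun i hi _ => hdα i hi⟩
  obtain ⟨y, hy, hyd, hxy⟩ := exists_pair_mem hD x d α
  have hext : ∀ n, (p n).Extends D y (y.xor d) := fun n =>
    ⟨hy, hyd, (hx n).trans (hxy.mono (hheight n).le),
      ((hx n).trans (hxy.mono (hheight n).le)).xor (hd n)⟩
  obtain ⟨b, hbα, v, hv⟩ := ((hST y (y.xor d)).1 (by simpa using hdS)).2 α ⟨hαT, s, hs, hsα⟩
  obtain ⟨n, hn⟩ := exists_lt_of_lt_isLUB_range hsα hbα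
  -- Step `n + 1` starts from an image height above `s n > b`, so both its difference and its
  -- agreement fall in the supposedly constant segment.
  obtain ⟨i, hi, hi', hne⟩ := (hpstep (n + 1)).exists_ne
  obtain ⟨j, hj, hj', heq⟩ := (hpstep (n + 1)).exists_eq
  have hvi := hv i ((hn.trans (hpstep n).lt_imageHeight).le.trans hi) (hi'.trans (himage (n + 2)))
  have hvj := hv j ((hn.trans (hs n.lt_succ_self)).le.trans hj) (hj'.trans (himage (n + 2)))
  rw [GenCantor.xor_apply, heq _ _ (hext (n + 2)), Bool.xor_self] at hvj
  rw [← hvj] at hvi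
  exact hne _ _ (hext (n + 2)) (by simpa using hvi)

end Irreducibility

/-! ### From reductions to a one-to-one embedding -/

section Embedding

variable {κ : Cardinal.{u}}

/-- König's theorem `κ < κ ^ cof κ` excludes `cof κ < κ`. -/
theorem uncountableRegular_of_powerlt_eq (h0 : ℵ₀ < κ) (hpow : κ ^< κ = κ) :
    UncountableRegular κ := by
  refine ⟨⟨h0.le, ?_⟩, h0⟩
  by_contra! hcof
  have h1 := Cardinal.le_powerlt κ hcof
  rw [hpow] at h1
  exact absurd (Cardinal.lt_power_cof_ord h0.le) (not_lt.2 h1)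

/-- The complement of `X` if it is `ω`-stationary, and the empty set otherwise. -/
noncomputable def stationaryCompl (X : Set κ.ord.ToType) : Set κ.ord.ToType :=
  open Classical in if IsStationaryOfLength ℵ₀ Xᶜ then Xᶜ else ∅

theorem stationaryCompl_subset (X : Set κ.ord.ToType) : stationaryCompl X ⊆ Xᶜ := by
  rw [stationaryCompl]
  split_ifs
  · exact subset_rfl
  · exact Set.empty_subset _

/-- The reduction requires a stationary source set. If `Xᶜ` is not stationary and `X \ Y` is not
either, then neither is `Yᶜ`; both sets are then replaced by `∅` and the identity is a reduction. -/
theorem exists_isBorelFunction_iff [UncountableRegular κ] (hpow : κ ^< κ = κ)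
    (X Y : Set κ.ord.ToType) :
    (∃ f : GenCantor κ → GenCantor κ, IsBorelFunction f ∧ ∀ x y,
      x.xor y ∈ smallSets (stationaryCompl X) ↔
        (f x).xor (f y) ∈ smallSets (stationaryCompl Y)) ↔
      SubsetNSOfLength κ ℵ₀ X Y := by
  have hdiff : Yᶜ \ Xᶜ = X \ Y := by
    ext i
    simp [and_comm]
  constructor
  · rintro ⟨f, hf, h⟩ hXY
    have hY : stationaryCompl Y = Yᶜ := if_pos (hXY.mono fun i hi => hi.2)
    refine not_reduction_of_isStationaryOfLength_diff (hXY.mono ?_) hf h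
    rw [hY, ← hdiff]
    exact Set.sdiff_subset_sdiff_right (stationaryCompl_subset X)
  · intro hXY
    by_cases hX : IsStationaryOfLength ℵ₀ Xᶜ
    · have hX' : stationaryCompl X = Xᶜ := if_pos hX
      rw [← hX'] at hX
      obtain ⟨f, hf, h⟩ := exists_continuous_reduction hpow hX (T := stationaryCompl Y)
        fun hcon => hXY (hcon.mono (by
          rw [hX', ← hdiff]
          exact Set.sdiff_subset_sdiff_left (stationaryCompl_subset Y)))
      exact ⟨f, fun U hU => .isOpen _ (hU.preimage hf), h⟩
    · have hY : ¬ IsStationaryOfLength ℵ₀ Yᶜ := fun hcon => by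
        have hsub : Yᶜ ⊆ Xᶜ ∪ X \ Y := fun i hi => by
          by_cases hiX : i ∈ X
          · exact .inr ⟨hiX, hi⟩
          · exact .inl hiX
        exact (hcon.mono hsub).of_union.elim hX hXY
      rw [stationaryCompl, stationaryCompl, if_neg hX, if_neg hY]
      exact ⟨id, fun U hU => .isOpen _ hU, fun _ _ => Iff.rfl⟩

theorem nonempty_relEmbedding (h0 : ℵ₀ < κ) (hpow : κ ^< κ = κ) :
    Nonempty (SubsetNSOfLength κ ℵ₀ ↪r (BorelReducible (κ := κ))) := by
  classical
  have hκ := uncountableRegular_of_powerlt_eq h0 hpow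
  obtain ⟨π, hπ⟩ := exists_enumeration_cofinal_fibres (Q := κ.ord.ToType)
    (Cardinal.mk_ord_toType κ).le
  let z : κ.ord.ToType := Classical.arbitrary _
  -- Each point is coded cofinally often, so `X` can be recovered from `v X` modulo bounded sets.
  -- Position `z` is left out to keep the twist an involution.
  let v : Set κ.ord.ToType → GenCantor κ := fun X i => decide (i ≠ z ∧ π i ∈ X)
  have hv : ∀ X, v X z = false := fun X => by simp [v]
  let F : Set κ.ord.ToType → BorelEquivRel κ := fun X => twistedRel z (v X) (stationaryCompl X)
  have hFr : ∀ X x y, (F X).toSetoid.r x y ↔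
      (GenCantor.twist z (v X) x).xor (GenCantor.twist z (v X) y) ∈
        smallSets (stationaryCompl X) := fun X x y => Iff.rfl
  have hinj : Function.Injective F := by
    intro X Y hXY
    let o : GenCantor κ := fun _ => false
    let w : GenCantor κ := fun i => decide (i = z)
    let y : GenCantor κ := GenCantor.twist z (v X) w
    have ho : ∀ u, GenCantor.twist z u o = o := fun u => rfl
    have hX : (F X).toSetoid.r o y := by
      rw [hFr, ho, GenCantor.twist_twist (hv X)]
      have how : ∀ i, o.xor w i = decide (i = z) := fun i => by
        rw [GenCantor.xor_apply]
        simp [o, w]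
      obtain ⟨b, hb⟩ := exists_gt z
      refine ⟨⟨b, fun i hi => ?_⟩, fun a ha => ?_⟩
      · rw [how]
        exact decide_eq_false (hb.trans_le hi).ne'
      · obtain ⟨-, s, hs, hsa⟩ := ha
        rcases lt_or_ge z a with hza | haz
        · obtain ⟨c, hzc, hca⟩ := exists_between_of_mem_omegaLimits ⟨s, hs, hsa⟩ hza
          refine ⟨c, hca, false, fun i hi _ => ?_⟩
          rw [how]
          exact decide_eq_false (hzc.trans_le hi).ne'
        · refine ⟨s 0, hs.lt_of_isLUB_range hsa 0, false, fun i _ hi => ?_⟩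
          rw [how]
          exact decide_eq_false (hi.trans_le haz).ne
    -- Untwisting `y` with `v Y` in place of `v X` leaves `w` plus the difference of `v X` and `v
    -- Y`, which must therefore be bounded.
    rw [hXY, hFr, ho] at hX
    obtain ⟨⟨b, hb⟩, -⟩ := hX
    obtain ⟨c, hc⟩ := exists_gt (max b z)
    ext q
    obtain ⟨i, hci, -, rfl⟩ := hπ q c
    have hiz : i ≠ z := (((le_max_right _ _).trans_lt hc).trans_le hci).ne'
    have hi := hb i (((le_max_left _ _).trans_lt hc).le.trans hci)
    rw [GenCantor.xor_apply] at hi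
    simpa [o, y, w, GenCantor.twist, v, hiz] using hi
  refine ⟨⟨⟨F, hinj⟩, fun {X Y} => ?_⟩⟩
  exact (borelReducible_twistedRel_iff (hv X) (hv Y)).trans (exists_isBorelFunction_iff hpow X Y)

end Embedding

/-! ### The case `κ = ω₁` under the continuum hypothesis -/

section OmegaOne

theorem aleph_one_powerlt_aleph_one (hCH : Cardinal.continuum.{u} = ℵ₁) :
    (ℵ₁ : Cardinal.{u}) ^< ℵ₁ = ℵ₁ := by
  have h1 : (ℵ₁ : Cardinal.{u}) ≠ 0 := (Cardinal.aleph_pos 1).ne'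
  conv_lhs => rw [← Cardinal.succ_aleph0]
  rw [Cardinal.powerlt_succ (by rw [Cardinal.succ_aleph0]; exact h1), Cardinal.succ_aleph0, ← hCH,
    Cardinal.continuum_power_aleph0]

/-- Initial segments of `ω₁` are countable, so a supremum not attained in a subset of `C` is already
the supremum of a strictly increasing ω-sequence from that subset. -/
theorem isClub_iff_isCubOfLength_aleph0 {C : Set (ℵ₁ : Cardinal.{u}).ord.ToType} :
    IsClub C ↔ IsCubOfLength ℵ₀ C := by
  constructor
  · intro hC
    refine ⟨isClosedOfLength_aleph0_iff.2 fun f _ hfC b hb => ?_, hC.isCofinal⟩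
    exact hC.isLUB_mem (Set.range_subset_iff.2 hfC) (Set.range_nonempty f) hb
  · rintro ⟨hC, hcof⟩
    refine ⟨fun d hdC hd _ a ha => ?_, hcof⟩
    by_cases had : a ∈ d
    · exact hdC had
    have hlt : ∀ i ∈ d, i < a := fun i hi =>
      lt_of_le_of_ne (ha.1 hi) fun h => had (h ▸ hi)
    have hcount : d.Countable := by
      have hsub : d ⊆ Set.Iio a := hlt
      refine Set.Countable.mono hsub ?_
      rw [← Cardinal.le_aleph0_iff_set_countable, ← Order.lt_succ_iff, Cardinal.succ_aleph0]
      exact mk_Iio_lt a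
    obtain ⟨e, he⟩ := hcount.exists_eq_range hd
    have hnext : ∀ i, i < a → ∃ j ∈ d, i < j := fun i hi => (lt_isLUB_iff ha).1 hi
    have hed : ∀ n, e n ∈ d := fun n => he ▸ Set.mem_range_self n
    have : Nonempty (ℵ₁ : Cardinal.{u}).ord.ToType := ⟨a⟩
    choose! s hsd hs using hnext
    let y : ℕ → (ℵ₁ : Cardinal.{u}).ord.ToType := fun n =>
      Nat.rec (e 0) (fun n x => s (max x (e n))) n
    have hy : ∀ n, y (n + 1) = s (max (y n) (e n)) := fun n => rfl
    have hyd : ∀ n, y n ∈ d := by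
      intro n
      induction n with
      | zero => exact hed 0
      | succ n ih => exact hsd _ (max_lt (hlt _ ih) (hlt _ (hed n)))
    have hmax : ∀ n, max (y n) (e n) < y (n + 1) := fun n =>
      hs _ (max_lt (hlt _ (hyd n)) (hlt _ (hed n)))
    refine isClosedOfLength_aleph0_iff.1 hC y (strictMono_nat_of_lt_succ fun n =>
      (le_max_left _ _).trans_lt (hmax n)) (fun n => hdC (hyd n)) a ⟨?_, fun b hb => ha.2 ?_⟩
    · rintro _ ⟨n, rfl⟩
      exact ha.1 (hyd n)
    · rw [he]
      rintro _ ⟨n, rfl⟩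
      exact ((le_max_right _ _).trans (hmax n).le).trans (hb ⟨n + 1, rfl⟩)

theorem subsetNS_aleph_one_eq :
    SubsetNS (ℵ₁ : Cardinal.{u}) = SubsetNSOfLength ℵ₁ ℵ₀ := by
  funext X Y
  simp only [SubsetNS, SubsetNSOfLength, IsStationary, IsStationaryOfLength,
    isClub_iff_isCubOfLength_aleph0]

theorem IsClub.preimage_orderIso {α β : Type*} [LinearOrder α] [LinearOrder β] {s : Set β}
    (hs : IsClub s) (e : α ≃o β) : IsClub (e ⁻¹' s) := by
  refine ⟨fun d hd hne _ a ha => ?_, fun a => ?_⟩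
  · exact hs.isLUB_mem (Set.image_subset_iff.2 hd) (hne.image e) (e.isLUB_image'.2 ha)
  · obtain ⟨b, hb, hab⟩ := hs.isCofinal (e a)
    exact ⟨e.symm b, by simpa using hb, e.le_symm_apply.2 hab⟩

theorem IsStationary.preimage_orderIso {α β : Type*} [LinearOrder α] [LinearOrder β] {s : Set β}
    (hs : IsStationary s) (e : α ≃o β) : IsStationary (e ⁻¹' s) := by
  intro t ht
  obtain ⟨b, hb, hbt⟩ := hs (ht.preimage_orderIso e.symm)
  exact ⟨e.symm b, by simpa using hb, hbt⟩

theorem isStationary_preimage_orderIso_iff {α β : Type*} [LinearOrder α] [LinearOrder β]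
    {s : Set β} (e : α ≃o β) : IsStationary (e ⁻¹' s) ↔ IsStationary s := by
  refine ⟨fun h => ?_, fun h => h.preimage_orderIso e⟩
  have h' := h.preimage_orderIso e.symm
  rwa [← Set.preimage_comp, show e ∘ e.symm = id from funext e.apply_symm_apply,
    Set.preimage_id] at h'

theorem nonempty_orderIso_aleph_one :
    Nonempty ((ℵ₁ : Cardinal.{u}).ord.ToType ≃o (ℵ₁ : Cardinal.{v}).ord.ToType) := by
  have h : Ordinal.lift.{max v u} (Ordinal.type (α := (ℵ₁ : Cardinal.{u}).ord.ToType) (· < ·)) =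
      Ordinal.lift.{max u v} (Ordinal.type (α := (ℵ₁ : Cardinal.{v}).ord.ToType) (· < ·)) := by
    simp
  obtain ⟨e⟩ := Ordinal.lift_type_eq.{u, v, max u v}.1 h
  exact ⟨OrderIso.ofRelIsoLT e⟩

theorem continuum_eq_aleph_one_of_universe (hCH : Cardinal.continuum.{u} = ℵ₁) :
    Cardinal.continuum.{v} = ℵ₁ := by
  have h := congrArg Cardinal.lift.{v} hCH
  apply Cardinal.lift_injective.{u}
  simpa using h

theorem nonempty_relIso_subsetNS_aleph_one :
    Nonempty (SubsetNS (ℵ₁ : Cardinal.{u}) ≃r SubsetNS (ℵ₁ : Cardinal.{v})) := by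
  obtain ⟨e⟩ := nonempty_orderIso_aleph_one.{v, u}
  refine ⟨⟨⟨fun X => e ⁻¹' X, fun Y => e.symm ⁻¹' Y, fun X => ?_, fun Y => ?_⟩,
    fun {X Y} => not_congr (isStationary_preimage_orderIso_iff e (s := X \ Y))⟩⟩
  · ext i
    simp
  · ext i
    simp

/-- The two copies of `ω₁` may live in different universes; they are order isomorphic, and
stationarity and the continuum hypothesis transfer between them. -/
theorem nonempty_relEmbedding_subsetNS (hCH : Cardinal.continuum.{u} = ℵ₁) :
    Nonempty (SubsetNS (ℵ₁ : Cardinal.{u}) ↪r BorelReducible (κ := (ℵ₁ : Cardinal.{v}))) := by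
  obtain ⟨e⟩ := nonempty_relIso_subsetNS_aleph_one.{u, v}
  obtain ⟨F⟩ := nonempty_relEmbedding Cardinal.aleph0_lt_aleph_one
    (aleph_one_powerlt_aleph_one (continuum_eq_aleph_one_of_universe.{u, v} hCH))
  rw [← subsetNS_aleph_one_eq] at F
  exact ⟨e.toRelEmbedding.trans F⟩

end OmegaOne

theorem corollary14 :
    (∀ κ : Cardinal.{u}, ℵ₀ < κ → κ ^< κ = κ →
      Nonempty (SubsetNSOfLength κ ℵ₀ ↪r (BorelReducible (κ := κ)))) ∧
    (Cardinal.continuum.{u} = ℵ₁ →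
      Nonempty (SubsetNS (ℵ₁ : Cardinal.{u}) ↪r (BorelReducible (κ := ℵ₁)))) := by
  exact ⟨fun κ h0 hpow => nonempty_relEmbedding h0 hpow, nonempty_relEmbedding_subsetNS⟩
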